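/- Let $\mathbf k$ be a field. A filtered complex $(A,d,F)$ is a cochain complex of $\mathbf k$-vector spaces with a decreasing filtration by subspaces $F^pA^n\subseteq A^n$, $d(F^pA^n)\subseteq F^pA^{n+1}$, which in each degree is exhaustive and bounded below ($F^pA^n=0$ for $p$ large). A filtered dg-algebra is a filtered complex with an associative product $\mu$ of degree $0$ satisfying the graded Leibniz rule and $\mu(F^pA\otimes F^qA)\subseteq F^{p+q}A$. A filtered homotopy transfer diagram from $(A,d,F)$ to $(B,d,F)$ consists of morphisms of filtered complexes $f:A\to B$, $g:B\to A$ and a linear map $h:A\to A$ of degree $-1$ with $h(F^pA^n)\subseteq F^pA^{n-1}$ and $hd+dh=1-gf$. Tensor products of maps follow the Koszul sign rule. Put $\theta(r_1,\dots,r_m)=\sum_{i<j}r_i(r_j+1)$ and, for an $n$-ary operation $\varphi$ of degree $|\varphi|$, $\delta\varphi=d\varphi-(-1)^{|\varphi|}\varphi\, d_{A^{\otimes n}}$. **Conventions.** An $A_\infty$-algebra $(A,d,\nu_s)$ is a complex with operations $\nu_s:A^{\otimes s}\to A$ of degree $2-s$, $s\ge2$, such that for $n\ge 2$ $$\delta\nu_n+\sum_{r+l=n+1,\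 r,l\ge2}\ \sum_{i=1}^{r}(-1)^{i(l+1)+n}\,\nu_r(1^{\otimes(i-1)}\otimes\nu_l\otimes1^{\otimes(r-i)})=0 ;$$ a dg-algebra is one with $\nu_2=\mu$ and $\nu_s=0$ for $s\ge3$. An $A_\infty$-morphism $\mathcal F:(A,d,\mu_s)\to(B,d,\nu_s)$ consists of maps $\mathcal F_s:A^{\otimes s}\to B$ of degree $1-s$, $s\ge1$, such that for $n\ge 1$ $$\delta \mathcal F_n=\sum_{\substack{r_1+\dots+r_m=n\\ m\ge2}}(-1)^{\theta(r_1,\dots,r_m)}\nu_m(\mathcal F_{r_1}\otimes\cdots\otimes \mathcal F_{r_m})+\sum_{\substack{r+l=n+1\\ l\ge2,\ 1\le i\le r}}(-1)^{i(l+1)+n}\mathcal F_r(1^{\otimes(i-1)}\otimes\mu_l\otimes1^{\otimes(r-i)}).$$ Composites are $(\mathcal G\mathcal F)_n=\sum_{r_1+\dots+r_m=n,\ m\ge 1}(-1)^{\theta(r_1,\dots,r_m)}\mathcal G_m(\mathcal F_{r_1}\otimes\cdots\otimes\mathcal F_{r_m})$, and the identity is $(\mathrm{id},0,0,\dots)$.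 An $A_\infty$-homotopy from $\mathcal F$ to $\mathcal F'$ (both $A_\infty$-morphisms $(A,d,\mu_s)\to(B,d,\nu_s)$) consists of maps $\mathcal H_s:A^{\otimes s}\to B$ of degree $-s$, $s\ge1$, such that for $n\ge 1$ $$\delta \mathcal H_n=\mathcal F_n-\mathcal F'_n+\sum_{\substack{r_1+\dots+r_m=n\\ m\ge2,\ 1\le i\le m}}(-1)^{\theta(r_1,\dots,r_m)+m-i+r_1+\cdots+r_{i-1}}\nu_m(\mathcal F'_{r_1}\otimes\cdots\otimes \mathcal F'_{r_{i-1}}\otimes \mathcal H_{r_i}\otimes \mathcal F_{r_{i+1}}\otimes\cdots\otimes \mathcal F_{r_m})$$ $$\qquad+\sum_{\substack{r+l=n+1\\ l\ge2,\ 1\le i\le r}}(-1)^{i(l+1)+n+1}\mathcal H_r(1^{\otimes(i-1)}\otimes\mu_l\otimes1^{\otimes(r-i)}).$$ An $A_\infty$-algebra on a filtered complex, or an $A_\infty$-morphism or $A_\infty$-homotopy between such, is *filtered* if each of its components $\varphi_s$ satisfies $\varphi_s(F^{p_1}A^{n_1}\otimes\cdots\otimes F^{p_s}A^{n_s})\subseteq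 F^{p_1+\cdots+p_s}$, in the degree $n_1+\dots+n_s+|\varphi_s|$; the two morphisms related by a filtered homotopy are required to be filtered. **Kernels.** Let $(A,d,\mu,F)$ be a filtered dg-algebra and $(f,g,h)$ a filtered homotopy transfer diagram from $A$ to $B$. Define, for $n\ge2$, $$\mathfrak p_n=\sum_{\substack{k+l=n\\ k,l\ge1}}(-1)^{k(l+1)}\mu\big((h\mathfrak p_k)\otimes(h\mathfrak p_l)\big),\qquad h\mathfrak p_1:=\mathrm{id},$$ $$\mathfrak q_1=\mathrm{id},\qquad \mathfrak q_n=-\mu\big((h\mathfrak q_{n-1})\otimes \mathrm{id}\big)+\sum_{j=1}^{n-1}(-1)^{jn-j^2}\mu\big((gf)_j\otimes (h\mathfrak q_{n-j})\big),$$ where, for $m\ge 1$, $$(gf)_m=gf\,\mathfrak q_m+\sum_{\substack{r_1+\dots+r_s=m\\ s\ge2}}(-1)^{\theta(r_1,\dots,r_s)}(h\mathfrak p_s)\big((gf\,\mathfrak q_{r_1})\otimes\cdots\otimes(gf\,\mathfrak q_{r_s})\big).$$ For $s\ge2$ put $\nu_s=f\circ\mathfrak p_s\circ g^{\otimes s}$,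 $\mathcal F_s=f\circ\mathfrak q_s$, $\mathcal G_s=h\circ\mathfrak p_s\circ g^{\otimes s}$, $\mathcal H_s=h\circ\mathfrak q_s$, and $\mathcal F_1=f$, $\mathcal G_1=g$, $\mathcal H_1=h$. **Proposition.** 1. $(B,d,\nu_s,F)$ is a filtered $A_\infty$-algebra. 2. $\mathcal F:A\to B$ and $\mathcal G:B\to A$ are filtered $A_\infty$-morphisms. 3. $\mathcal H$ is a filtered $A_\infty$-homotopy from the identity of $A$ to $\mathcal G\mathcal F$. -/

import Mathlib

/-!
Filtered complexes over a field, filtered dg-algebras, filtered homotopy transfer diagrams,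
filtered `A_∞`-algebras, `A_∞`-morphisms and `A_∞`-homotopies, and the `p`- and `q`-kernels.

Graded vector spaces are internally graded: a vector space `A` with subspaces `gr n = A^n` whose
internal direct sum is `A`.  The differentials have degree `+1`.  A linear map `A^{⊗ n} → B` is a
multilinear map in `n` variables.  Tensor products of graded maps follow the Koszul rule
`(φ ⊗ ψ)(x ⊗ y) = (-1)^{|ψ| |x|} φ(x) ⊗ ψ(y)`; the sign is implemented by powers of the grading
involution `γ x = (-1)^{|x|} x`.
-/

namespace FilteredTransfer

open Finset

/-- `n`-ary operations, i.e. linear maps `A^{⊗ n} → B`. -/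
abbrev Op (k A B : Type*) [Field k] [AddCommGroup A] [Module k A] [AddCommGroup B] [Module k B]
    (n : ℕ) := MultilinearMap k (fun _ : Fin n => A) B

/-! ### Filtered complexes -/

/-- A cochain complex `(A, d, F)` with a decreasing filtration `fil p n = F^p A^n` by subcomplexes,
exhaustive and bounded below in each degree. -/
structure FilteredComplex (k A : Type*) [Field k] [AddCommGroup A] [Module k A] where
  /-- `gr n = A^n` -/
  gr : ℤ → Submodule k A
  isInternal : DirectSum.IsInternal gr
  /-- the differential -/
  d : A →ₗ[k] A
  d_mem : ∀ n, ∀ x ∈ gr n, d x ∈ gr (n + 1)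
  d_d : ∀ x, d (d x) = 0
  /-- `fil p n = F^p A^n` -/
  fil : ℤ → ℤ → Submodule k A
  fil_le : ∀ p n, fil p n ≤ gr n
  fil_anti : ∀ p n, fil (p + 1) n ≤ fil p n
  d_fil : ∀ p n, ∀ x ∈ fil p n, d x ∈ fil p (n + 1)
  exhaustive : ∀ n, ∀ x ∈ gr n, ∃ p, x ∈ fil p n
  bounded_below : ∀ n, ∃ p, fil p n = ⊥

section
variable {k A : Type*} [Field k] [AddCommGroup A] [Module k A]

/-- The grading involution, the linear map with `γ x = (-1)^n x` for `x ∈ A^n`. -/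
noncomputable def FilteredComplex.invol (X : FilteredComplex k A) : A →ₗ[k] A :=
  (DirectSum.toModule k ℤ A fun n => ((n.negOnePow : ℤˣ) : ℤ) • (X.gr n).subtype) ∘ₗ
    (LinearEquiv.ofBijective (DirectSum.coeLinearMap X.gr) X.isInternal).symm.toLinearMap

theorem FilteredComplex.invol_of_mem (X : FilteredComplex k A) {n : ℤ} {x : A} (hx : x ∈ X.gr n) :
    X.invol x = ((n.negOnePow : ℤˣ) : ℤ) • x := by
  have h : (LinearEquiv.ofBijective (DirectSum.coeLinearMap X.gr) X.isInternal).symm x =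
      DirectSum.lof k ℤ (fun i => X.gr i) n ⟨x, hx⟩ := by
    rw [LinearEquiv.symm_apply_eq]
    exact (DirectSum.coeLinearMap_lof (A := X.gr) n ⟨x, hx⟩).symm
  simp only [FilteredComplex.invol, LinearMap.comp_apply, LinearEquiv.coe_coe, h]
  simp [DirectSum.toModule_lof]

end

/-- A filtered dg-algebra: a filtered complex with an associative product of degree `0` satisfying
the graded Leibniz rule and `F^p A · F^q A ⊆ F^{p+q} A`. No unit is required. -/
structure FilteredDGAlgebra (k A : Type*) [Field k] [AddCommGroup A] [Module k A] extends
    FilteredComplex k A where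
  /-- the product -/
  mul : A →ₗ[k] A →ₗ[k] A
  mul_mem : ∀ m n, ∀ x ∈ gr m, ∀ y ∈ gr n, mul x y ∈ gr (m + n)
  mul_assoc : ∀ x y z, mul (mul x y) z = mul x (mul y z)
  leibniz : ∀ m, ∀ x ∈ gr m, ∀ y,
    d (mul x y) = mul (d x) y + ((m.negOnePow : ℤˣ) : ℤ) • mul x (d y)
  mul_fil : ∀ p q m n, ∀ x ∈ fil p m, ∀ y ∈ fil q n, mul x y ∈ fil (p + q) (m + n)

/-- A filtered homotopy transfer diagram: morphisms of filtered complexes `f : A → B`,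
`g : B → A`, and a filtered homotopy `h` from the identity of `A` to `g f`. -/
structure TransferDiagram {k A B : Type*} [Field k] [AddCommGroup A] [Module k A]
    [AddCommGroup B] [Module k B] (X : FilteredComplex k A) (Y : FilteredComplex k B) where
  f : A →ₗ[k] B
  f_mem : ∀ n, ∀ x ∈ X.gr n, f x ∈ Y.gr n
  f_d : ∀ x, f (X.d x) = Y.d (f x)
  f_fil : ∀ p n, ∀ x ∈ X.fil p n, f x ∈ Y.fil p n
  g : B →ₗ[k] A
  g_mem : ∀ n, ∀ y ∈ Y.gr n, g y ∈ X.gr n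
  g_d : ∀ y, g (Y.d y) = X.d (g y)
  g_fil : ∀ p n, ∀ y ∈ Y.fil p n, g y ∈ X.fil p n
  h : A →ₗ[k] A
  h_mem : ∀ n, ∀ x ∈ X.gr n, h x ∈ X.gr (n - 1)
  h_fil : ∀ p n, ∀ x ∈ X.fil p n, h x ∈ X.fil p (n - 1)
  homotopy : ∀ x, h (X.d x) + X.d (h x) = x - g (f x)

/-! ### Tensor products of operations and their compositions -/

section
variable {k A B C : Type*} [Field k] [AddCommGroup A] [Module k A] [AddCommGroup B] [Module k B]
  [AddCommGroup C] [Module k C]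

/-- The identity as a unary operation. -/
def idOp (k A : Type*) [Field k] [AddCommGroup A] [Module k A] : Op k A A 1 :=
  MultilinearMap.ofSubsingleton k A A 0 LinearMap.id

/-- `μ ∘ (φ ⊗ ψ)`, where `ψ` has degree `e` mod `2` and `γ` is the grading involution of the
inputs. -/
def mulTensor (γ : A →ₗ[k] A) (μ : A →ₗ[k] A →ₗ[k] A) {a b n : ℕ} (hn : a + b = n)
    (φ : Op k A A a) (ψ : Op k A A b) (e : ℕ) : Op k A A n :=
  ((TensorProduct.lift μ).compMultilinearMap
    (MultilinearMap.domCoprod (φ.compLinearMap fun _ => γ ^ e) ψ)).domDomCongr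
      (finSumFinEquiv.trans (finCongr hn))

theorem mulTensor_apply (γ : A →ₗ[k] A) (μ : A →ₗ[k] A →ₗ[k] A) {a b n : ℕ} (hn : a + b = n)
    (φ : Op k A A a) (ψ : Op k A A b) (e : ℕ) (x : Fin n → A) :
    mulTensor γ μ hn φ ψ e x =
      μ (φ fun i => (γ ^ e) (x (finCongr hn (Fin.castAdd b i))))
        (ψ fun j => x (finCongr hn (Fin.natAdd a j))) := by
  simp [mulTensor]

/-- `φ ∘ (ψ_1 ⊗ ⋯ ⊗ ψ_r)` for a composition `c = (r_1, …, r_r)` of `n`, where `ψ_i` has arity `r_i`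
and degree `e i` mod `2`, and `γ` is the grading involution of the inputs. -/
def blockComp (γ : A →ₗ[k] A) {n : ℕ} (c : Composition n) (φ : Op k B C c.length)
    (ψ : ∀ i, Op k A B (c.blocksFun i)) (e : Fin c.length → ℕ) : Op k A C n :=
  (φ.compMultilinearMap fun i =>
    (ψ i).compLinearMap fun _ => γ ^ (∑ j ∈ Ioi i, e j)).domDomCongr c.blocksFinEquiv

theorem blockComp_apply (γ : A →ₗ[k] A) {n : ℕ} (c : Composition n) (φ : Op k B C c.length)
    (ψ : ∀ i, Op k A B (c.blocksFun i)) (e : Fin c.length → ℕ) (x : Fin n → A) :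
    blockComp γ c φ ψ e x =
      φ fun i => ψ i fun b => (γ ^ (∑ j ∈ Ioi i, e j)) (x (c.embedding i b)) := by
  rfl

/-- The exponent `∑_{i < j} r_i (r_j + 1)` for `c = (r_1, …, r_k)`. -/
def theta {n : ℕ} (c : Composition n) : ℕ :=
  ∑ i, ∑ j ∈ Ioi i, c.blocksFun i * (c.blocksFun j + 1)

/-- The `m`-th entry (counted from `0`) of an `n`-tuple; only used for `m < n`. -/
def entry {n : ℕ} (x : Fin n → A) (m : ℕ) : A := if hm : m < n then x ⟨m, hm⟩ else 0

/-- `φ ∘ (1^{⊗ i} ⊗ ψ ⊗ 1^{⊗ (r - i - 1)})` evaluated at `x = (x_0, …, x_{n-1})`, where `φ` has arity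
`r`, `ψ` has arity `l` and degree `e` mod `2`, `i < r`, and `n = r + l - 1`. -/
def insertAt (γ : A →ₗ[k] A) {r l n : ℕ} (φ : Op k A B r) (i : ℕ) (ψ : Op k A A l) (e : ℕ)
    (x : Fin n → A) : B :=
  φ fun a =>
    if (a : ℕ) < i then (γ ^ e) (entry x a)
    else if (a : ℕ) = i then ψ fun b => entry x (i + b)
    else entry x (a + l - 1)

/-- The differential of an operation of degree `e` mod `2`:
`δ φ = d ∘ φ - (-1)^e ∑_i φ ∘ (1^{⊗ i} ⊗ d ⊗ 1^{⊗ (n - i - 1)})`, evaluated at `x`. -/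
noncomputable def delta (X : FilteredComplex k A) (Y : FilteredComplex k B) {n : ℕ} (φ : Op k A B n) (e : ℕ)
    (x : Fin n → A) : B :=
  Y.d (φ x) - (-1 : ℤ) ^ e • ∑ i ∈ range n,
    insertAt X.invol φ i (X.d.compMultilinearMap (idOp k A)) 1 x

end

/-! ### Filtered `A_∞`-algebras, morphisms and homotopies

Everywhere, only the components of positive arity of a family of operations are relevant, and for
the higher products of an `A_∞`-algebra only those of arity at least `2`; the unary operation of an
`A_∞`-algebra is the differential `d` of the underlying complex.

There are several equivalent sign conventions for `A_∞`-structures, which differ by rescaling the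
components by signs that depend on the arity.  The one used here makes a dg-algebra `(A, d, μ)` an
`A_∞`-algebra with `ν_2 = μ` and no further products, and is adapted to homotopies from the identity
to `g f` being normalised as `h d + d h = 1 - g f`. It is
Markl's convention for `((-1)^s ν_s)`, `((-1)^{s-1} F_s)` and `((-1)^s H_s)`. -/

section
variable {k A B C : Type*} [Field k] [AddCommGroup A] [Module k A] [AddCommGroup B] [Module k B]
  [AddCommGroup C] [Module k C]

/-- The filtered complex `X` with the operations `ν_s` of degree `2 - s`, `s ≥ 2`, is a filtered
`A_∞`-algebra. The relations are
`δ ν_n + ∑ (-1)^{i(l+1)+n} ν_r (1^{⊗ (i-1)} ⊗ ν_l ⊗ 1^{⊗ (r-i)}) = 0` for `n ≥ 2`,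
the sum being over `r + l = n + 1`, `r, l ≥ 2`, `1 ≤ i ≤ r` (in the code `i` starts at `0`). -/
structure IsFilteredAInfAlgebra (X : FilteredComplex k A) (ν : ∀ n, Op k A A n) : Prop where
  degree : ∀ n, 2 ≤ n → ∀ (a : Fin n → ℤ) (x : Fin n → A), (∀ i, x i ∈ X.gr (a i)) →
    ν n x ∈ X.gr (∑ i, a i - n + 2)
  relation : ∀ n, 2 ≤ n → ∀ x : Fin n → A,
    delta X X (ν n) n x +
      ∑ l ∈ Ico 2 n, ∑ i ∈ range (n + 1 - l),
        (-1 : ℤ) ^ ((i + 1) * (l + 1) + n) • insertAt X.invol (ν (n + 1 - l)) i (ν l) l x = 0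
  filtered : ∀ n, 2 ≤ n → ∀ (p a : Fin n → ℤ) (x : Fin n → A), (∀ i, x i ∈ X.fil (p i) (a i)) →
    ν n x ∈ X.fil (∑ i, p i) (∑ i, a i - n + 2)

/-- The operations `F_s : A^{⊗ s} → B` of degree `1 - s`, `s ≥ 1`, form a filtered `A_∞`-morphism
from `(X, μ)` to `(Y, ν)`. The relations are, for `n ≥ 1`,
`δ F_n = ∑ (-1)^{θ(r_1,…,r_m)} ν_m (F_{r_1} ⊗ ⋯ ⊗ F_{r_m})
  + ∑ (-1)^{i(l+1)+n} F_r (1^{⊗ (i-1)} ⊗ μ_l ⊗ 1^{⊗ (r-i)})`,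
the first sum being over `r_1 + ⋯ + r_m = n`, `m ≥ 2`, the second one over `r + l = n + 1`, `l ≥ 2`,
`1 ≤ i ≤ r`. -/
structure IsFilteredAInfMorphism (X : FilteredComplex k A) (μ : ∀ n, Op k A A n)
    (Y : FilteredComplex k B) (ν : ∀ n, Op k B B n) (F : ∀ n, Op k A B n) : Prop where
  degree : ∀ n, 1 ≤ n → ∀ (a : Fin n → ℤ) (x : Fin n → A), (∀ i, x i ∈ X.gr (a i)) →
    F n x ∈ Y.gr (∑ i, a i - n + 1)
  relation : ∀ n, 1 ≤ n → ∀ x : Fin n → A,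
    delta X Y (F n) (n + 1) x =
      ∑ c : Composition n with 2 ≤ c.length, (-1 : ℤ) ^ theta c •
        blockComp X.invol c (ν c.length) (fun i => F (c.blocksFun i))
          (fun i => c.blocksFun i + 1) x +
      ∑ l ∈ Icc 2 n, ∑ i ∈ range (n + 1 - l),
        (-1 : ℤ) ^ ((i + 1) * (l + 1) + n) • insertAt X.invol (F (n + 1 - l)) i (μ l) l x
  filtered : ∀ n, 1 ≤ n → ∀ (p a : Fin n → ℤ) (x : Fin n → A), (∀ i, x i ∈ X.fil (p i) (a i)) →
    F n x ∈ Y.fil (∑ i, p i) (∑ i, a i - n + 1)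

/-- The operations `H_s : A^{⊗ s} → B` of degree `-s`, `s ≥ 1`, form a filtered `A_∞`-homotopy from
the filtered `A_∞`-morphism `F` to the filtered `A_∞`-morphism `G`, both from `(X, μ)` to `(Y, ν)`.
The relations are, for `n ≥ 1`,
`δ H_n = F_n - G_n + ∑ (-1)^{θ(r_1,…,r_m) + (m-i) + r_1 + ⋯ + r_{i-1}}
    ν_m (G_{r_1} ⊗ ⋯ ⊗ G_{r_{i-1}} ⊗ H_{r_i} ⊗ F_{r_{i+1}} ⊗ ⋯ ⊗ F_{r_m})
  + ∑ (-1)^{i(l+1)+n+1} H_r (1^{⊗ (i-1)} ⊗ μ_l ⊗ 1^{⊗ (r-i)})`,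
the first sum being over `r_1 + ⋯ + r_m = n`, `m ≥ 2`, `1 ≤ i ≤ m`, the second one over
`r + l = n + 1`, `l ≥ 2`, `1 ≤ i ≤ r`. For `n = 1` this is `d H_1 + H_1 d = F_1 - G_1`. -/
structure IsFilteredAInfHomotopy (X : FilteredComplex k A) (μ : ∀ n, Op k A A n)
    (Y : FilteredComplex k B) (ν : ∀ n, Op k B B n) (F G H : ∀ n, Op k A B n) : Prop where
  source : IsFilteredAInfMorphism X μ Y ν F
  target : IsFilteredAInfMorphism X μ Y ν G
  degree : ∀ n, 1 ≤ n → ∀ (a : Fin n → ℤ) (x : Fin n → A), (∀ i, x i ∈ X.gr (a i)) →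
    H n x ∈ Y.gr (∑ i, a i - n)
  relation : ∀ n, 1 ≤ n → ∀ x : Fin n → A,
    delta X Y (H n) n x =
      F n x - G n x +
      ∑ c : Composition n with 2 ≤ c.length, ∑ i : Fin c.length,
        (-1 : ℤ) ^ (theta c + (c.length - ((i : ℕ) + 1)) + ∑ j ∈ Iio i, c.blocksFun j) •
          blockComp X.invol c (ν c.length)
            (fun j => if j < i then G (c.blocksFun j)
              else if j = i then H (c.blocksFun j) else F (c.blocksFun j))
            (fun j => if j = i then c.blocksFun j else c.blocksFun j + 1) x +
      ∑ l ∈ Icc 2 n, ∑ i ∈ range (n + 1 - l),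
        (-1 : ℤ) ^ ((i + 1) * (l + 1) + n + 1) • insertAt X.invol (H (n + 1 - l)) i (μ l) l x
  filtered : ∀ n, 1 ≤ n → ∀ (p a : Fin n → ℤ) (x : Fin n → A), (∀ i, x i ∈ X.fil (p i) (a i)) →
    H n x ∈ Y.fil (∑ i, p i) (∑ i, a i - n)

/-- The composite `G F` of two `A_∞`-morphisms:
`(G F)_n = ∑ (-1)^{θ(r_1,…,r_m)} G_m (F_{r_1} ⊗ ⋯ ⊗ F_{r_m})` over `r_1 + ⋯ + r_m = n`. -/
noncomputable def compAInf (X : FilteredComplex k A) (G : ∀ n, Op k B C n) (F : ∀ n, Op k A B n) (n : ℕ) :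
    Op k A C n :=
  ∑ c : Composition n, (-1 : ℤ) ^ theta c •
    blockComp X.invol c (G c.length) (fun i => F (c.blocksFun i)) (fun i => c.blocksFun i + 1)

/-- The identity `A_∞`-morphism, with components `id, 0, 0, …`. -/
def idAInf (k A : Type*) [Field k] [AddCommGroup A] [Module k A] : ∀ n, Op k A A n
  | 1 => idOp k A
  | _ => 0

/-- The higher products `μ, 0, 0, …` of a dg-algebra, regarded as an `A_∞`-algebra. -/
noncomputable def FilteredDGAlgebra.products (X : FilteredDGAlgebra k A) : ∀ n, Op k A A n
  | 2 => mulTensor X.invol X.mul rfl (idOp k A) (idOp k A) 0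
  | _ => 0

end

/-! ### The kernels -/

section
variable {k A : Type*} [Field k] [AddCommGroup A] [Module k A]

/-- `h ∘ φ` in arity `n ≠ 1`, and the identity in arity `1`. -/
def applyH (h : A →ₗ[k] A) : (n : ℕ) → Op k A A n → Op k A A n
  | 1, _ => idOp k A
  | _, φ => h.compMultilinearMap φ

/-- The `p`-kernels:
`p_n = ∑_{a + b = n, a, b ≥ 1} (-1)^{a(b+1)} μ ((h ∘ p_a) ⊗ (h ∘ p_b))`, with the convention
`h ∘ p_1 = id`; here `n` is written `m + 2`, and `a = j + 1`, `b = m + 1 - j`. The operation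
`h ∘ p_b` has degree `1 - b`. (The value in arity `0` and `1` is irrelevant.) -/
noncomputable def pKernel (γ : A →ₗ[k] A) (μ : A →ₗ[k] A →ₗ[k] A) (h : A →ₗ[k] A) :
    (n : ℕ) → Op k A A n
  | 0 => 0
  | 1 => 0
  | m + 2 => ∑ j : Fin (m + 1), (-1 : ℤ) ^ (((j : ℕ) + 1) * ((m + 1 - (j : ℕ)) + 1)) •
      mulTensor γ μ (by omega : ((j : ℕ) + 1) + (m + 1 - (j : ℕ)) = m + 2)
        (applyH h (j + 1) (pKernel γ μ h (j + 1)))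
        (applyH h (m + 1 - (j : ℕ)) (pKernel γ μ h (m + 1 - (j : ℕ))))
        ((m + 1 - (j : ℕ)) + 1)

/-- The operations `h ∘ p_n`, with the convention `h ∘ p_1 = id`. -/
noncomputable def hpKernel (γ : A →ₗ[k] A) (μ : A →ₗ[k] A →ₗ[k] A) (h : A →ₗ[k] A) (n : ℕ) :
    Op k A A n :=
  applyH h n (pKernel γ μ h n)

/-- For `u = g ∘ f` and a family `q`, the operations
`(gf)_m = u ∘ q_m + ∑ (-1)^{θ(r_1,…,r_s)} (h ∘ p_s) ((u ∘ q_{r_1}) ⊗ ⋯ ⊗ (u ∘ q_{r_s}))`,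
the sum being over `r_1 + ⋯ + r_s = m`, `s ≥ 2`. -/
noncomputable def gfKernel (γ : A →ₗ[k] A) (μ : A →ₗ[k] A →ₗ[k] A) (h u : A →ₗ[k] A)
    (q : ∀ n, Op k A A n) (m : ℕ) : Op k A A m :=
  u.compMultilinearMap (q m) +
    ∑ c : Composition m with 2 ≤ c.length, (-1 : ℤ) ^ theta c •
      blockComp γ c (hpKernel γ μ h c.length) (fun i => u.compMultilinearMap (q (c.blocksFun i)))
        (fun i => c.blocksFun i + 1)

/-- The `q`-kernels, for `u = g ∘ f`: `q_1 = id` and, for `n ≥ 2`,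
`q_n = - μ ((h ∘ q_{n-1}) ⊗ id) + ∑_{j=1}^{n-1} (-1)^{j(n-j)} μ ((gf)_j ⊗ (h ∘ q_{n-j}))`; here `n` is
written `m + 2` and `j` is written `j + 1`. The operation `h ∘ q_b` has degree `-b`. The
truncation of the family `q` to arities `< n` does not affect `(gf)_j` for `j < n`; see
`qKernel_add_two`. -/
noncomputable def qKernel (γ : A →ₗ[k] A) (μ : A →ₗ[k] A →ₗ[k] A) (h u : A →ₗ[k] A) :
    (n : ℕ) → Op k A A n
  | 0 => 0
  | 1 => idOp k A
  | m + 2 =>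
    - mulTensor γ μ rfl (h.compMultilinearMap (qKernel γ μ h u (m + 1))) (idOp k A) 0 +
      ∑ j : Fin (m + 1), (-1 : ℤ) ^ (((j : ℕ) + 1) * (m + 1 - (j : ℕ))) •
        mulTensor γ μ (by omega : ((j : ℕ) + 1) + (m + 1 - (j : ℕ)) = m + 2)
          (gfKernel γ μ h u
            (fun r => if _hr : r < m + 2 then qKernel γ μ h u r else 0) (j + 1))
          (h.compMultilinearMap (qKernel γ μ h u (m + 1 - (j : ℕ))))
          (m + 1 - (j : ℕ))

theorem gfKernel_congr (γ : A →ₗ[k] A) (μ : A →ₗ[k] A →ₗ[k] A) (h u : A →ₗ[k] A)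
    (q q' : ∀ n, Op k A A n) (m : ℕ) (hq : ∀ r ≤ m, q r = q' r) :
    gfKernel γ μ h u q m = gfKernel γ μ h u q' m := by
  unfold gfKernel
  rw [hq m le_rfl]
  congr 1
  refine Finset.sum_congr rfl fun c _ => ?_
  congr 2
  funext i
  rw [hq _ (c.blocksFun_le i)]

theorem qKernel_add_two (γ : A →ₗ[k] A) (μ : A →ₗ[k] A →ₗ[k] A) (h u : A →ₗ[k] A) (m : ℕ) :
    qKernel γ μ h u (m + 2) =
      - mulTensor γ μ rfl (h.compMultilinearMap (qKernel γ μ h u (m + 1))) (idOp k A) 0 +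
      ∑ j : Fin (m + 1), (-1 : ℤ) ^ (((j : ℕ) + 1) * (m + 1 - (j : ℕ))) •
        mulTensor γ μ (by omega : ((j : ℕ) + 1) + (m + 1 - (j : ℕ)) = m + 2)
          (gfKernel γ μ h u (qKernel γ μ h u) (j + 1))
          (h.compMultilinearMap (qKernel γ μ h u (m + 1 - (j : ℕ))))
          (m + 1 - (j : ℕ)) := by
  rw [qKernel]
  congr 1
  refine Finset.sum_congr rfl fun j _ => ?_
  congr 2
  refine gfKernel_congr γ μ h u _ _ _ fun r hr => ?_
  rw [dif_pos (by omega)]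

end

/-! ### The transferred structure -/

section
variable {k A B : Type*} [Field k] [AddCommGroup A] [Module k A] [AddCommGroup B] [Module k B]
  (X : FilteredDGAlgebra k A) {Y : FilteredComplex k B}
  (T : TransferDiagram X.toFilteredComplex Y)

/-- `ν_s = f ∘ p_s ∘ g^{⊗ s}`, for `s ≥ 2`. -/
noncomputable def transferProducts (s : ℕ) : Op k B B s :=
  T.f.compMultilinearMap ((pKernel X.invol X.mul T.h s).compLinearMap fun _ => T.g)

/-- `F_s = f ∘ q_s`; in particular `F_1 = f`. -/
noncomputable def transferF (s : ℕ) : Op k A B s :=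
  T.f.compMultilinearMap (qKernel X.invol X.mul T.h (T.g ∘ₗ T.f) s)

/-- `G_s = h ∘ p_s ∘ g^{⊗ s}`; in particular `G_1 = g`. -/
noncomputable def transferG (s : ℕ) : Op k B A s :=
  (hpKernel X.invol X.mul T.h s).compLinearMap fun _ => T.g

/-- `H_s = h ∘ q_s`; in particular `H_1 = h`. -/
noncomputable def transferH (s : ℕ) : Op k A A s :=
  T.h.compMultilinearMap (qKernel X.invol X.mul T.h (T.g ∘ₗ T.f) s)

theorem transferF_one (x : Fin 1 → A) : transferF X T 1 x = T.f (x 0) := by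
  simp [transferF, qKernel, idOp]

theorem transferG_one (y : Fin 1 → B) : transferG X T 1 y = T.g (y 0) := by
  simp [transferG, hpKernel, applyH, idOp]

theorem transferH_one (x : Fin 1 → A) : transferH X T 1 x = T.h (x 0) := by
  simp [transferH, qKernel, idOp]

end

end FilteredTransfer

/-!
The transfer formulas become sign-free, and the induction behind them short, after passing to the
bar construction.

Let `γ` be the grading involution of `A` and `σ = -γ`, the grading involution of the suspension. A
family of operations `φ_n` is turned into the function of words (`bar`)
`x₁ … x_n ↦ (-1)^{n(n-1)/2} φ_n (γ^{n-1} x₁, …, γ x_{n-1}, x_n)`.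
Under this translation

* operations of degree `1 - n` become even and operations of degree `-n` become odd with respect to
  `σ` (`HasParity.bar_even`, `HasParity.bar_odd`);
* `μ ∘ (φ ⊗ ψ)` becomes the convolution product `a * b` of functions of words for
  `m (x, y) = μ (γ x, y)` (`mulTensor_eq_bar_shift`, `mulTensor_eq_bar`);
* the sums of insertions become the derivation `D` of the convolution product which is dual to the
  coderivation with components `b = d - ν` (`sum_insertAt_eq_bar`, `delta_eq_bar`, `coder_conv`);
* the sums over compositions become composition with the coalgebra map with components `F`, and
  this is multiplicative for the convolution product (`sum_blockComp_eq_subst`, `subst_conv`).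

Write `1` for the projection to words of length one. The kernels satisfy
`G = g - h (G * G)`, `ν = - f (G * G)`, `Q = 1 - H * 1 - σ K * H`, where `F = f Q`, `H = h Q`, and
the composite `K = G F` satisfies `K = g f Q - h (K * K)`. What has to be proved is that the
following expressions vanish:

* `E = d G + G * G - D G` for `G`, and the same expression for `K`;
* `f R`, where `R = d Q + K * K - D Q`;
* `W = d H + D H - (Q - K)`.

For `G`, the Bianchi identity (`BarAlgebra.bianchi`) and `h d + d h = 1 - g f` give
`E = - h (E * G + σ G * E)`, so that `E = 0` by induction on the length of words
(`maurerCartan_transfer`); the relations for `ν` are another instance of the Bianchi identity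
(`transferred_relation`). For the `q`-kernel the same computation gives
`W = - h R`, `E = g f R - h (E * K + σ K * E)` and `R = W * 1 + K * W - σ E * H`, and all three vanish
by a simultaneous induction (`qKernel_identities`). In particular it is not necessary to know
beforehand that composites of `A_∞`-morphisms are `A_∞`-morphisms.

Degrees and filtrations are treated together (`HasDegree`): the families of subspaces `A^n`, indexed
by `ℤ`, and `F^p A^n`, indexed by `ℤ × ℤ`, are both respected by all the maps of the diagram.
-/

namespace FilteredTransfer

open Finset

/-! ### Sums over the factorizations of a word -/

section Words
variable {α β M N : Type*} [AddCommMonoid M] [AddCommMonoid N]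

/-- The sum of `f u v` over all factorizations `w = u ++ v` (deconcatenation). -/
def splitSum (f : List α → List α → M) : List α → M
  | [] => f [] []
  | x :: w => f [] (x :: w) + splitSum (fun u v => f (x :: u) v) w

theorem splitSum_congr {f g : List α → List α → M} {w : List α}
    (hfg : ∀ u v, u ++ v = w → f u v = g u v) : splitSum f w = splitSum g w := by
  induction w generalizing f g with
  | nil => exact hfg _ _ rfl
  | cons x w ih =>
    simp only [splitSum]
    rw [hfg [] _ rfl, ih fun u v huv => hfg (x :: u) v (by simp [huv])]

theorem splitSum_add (f g : List α → List α → M) (w : List α) :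
    splitSum (fun u v => f u v + g u v) w = splitSum f w + splitSum g w := by
  induction w generalizing f g with
  | nil => rfl
  | cons x w ih => simp only [splitSum, ih]; abel

theorem splitSum_zero (w : List α) : splitSum (fun _ _ => (0 : M)) w = 0 := by
  induction w with
  | nil => rfl
  | cons x w ih => simp [splitSum, ih]

theorem splitSum_hom {F : Type*} [FunLike F M N] [AddMonoidHomClass F M N] (L : F)
    (f : List α → List α → M) (w : List α) :
    splitSum (fun u v => L (f u v)) w = L (splitSum f w) := by
  induction w generalizing f with
  | nil => rfl
  | cons x w ih => simp only [splitSum, ih, map_add]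

theorem splitSum_map (s : α → β) (f : List β → List β → M) (w : List α) :
    splitSum f (w.map s) = splitSum (fun u v => f (u.map s) (v.map s)) w := by
  induction w generalizing f with
  | nil => rfl
  | cons x w ih => simp only [splitSum, List.map_cons, List.map_nil, ih]

theorem splitSum_append_cons (f : List α → List α → M) (u t : List α) (x : α) :
    splitSum f (u ++ x :: t) =
      splitSum (fun u₁ u₂ => f u₁ (u₂ ++ x :: t)) u +
        splitSum (fun t₁ t₂ => f (u ++ x :: t₁) t₂) t := by
  induction u generalizing f with
  | nil => rfl
  | cons y u ih => simp only [splitSum, List.cons_append, ih, add_assoc]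

theorem splitSum_comm (f : List α → List α → List β → List β → M) (w : List α) (w' : List β) :
    splitSum (fun u v => splitSum (fun u' v' => f u v u' v') w') w =
      splitSum (fun u' v' => splitSum (fun u v => f u v u' v') w) w' := by
  induction w generalizing f with
  | nil => rfl
  | cons x w ih => simp only [splitSum, ih, splitSum_add]

theorem splitSum_assoc (f : List α → List α → List α → M) (w : List α) :
    splitSum (fun u v => splitSum (fun u₁ u₂ => f u₁ u₂ v) u) w =
      splitSum (fun u v => splitSum (fun v₁ v₂ => f u v₁ v₂) v) w := by
  induction w generalizing f with
  | nil => rfl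
  | cons x w ih => simp only [splitSum, splitSum_add, ih, add_assoc]

theorem splitSum_eq_left {f : List α → List α → M} {w : List α}
    (hf : ∀ u v, v ≠ [] → f u v = 0) : splitSum f w = f w [] := by
  induction w generalizing f with
  | nil => rfl
  | cons x w ih =>
    rw [splitSum, hf _ _ (by simp), zero_add, ih fun u v hv => hf _ _ hv]

theorem splitSum_eq_right {f : List α → List α → M} {w : List α}
    (hf : ∀ u v, u ≠ [] → f u v = 0) : splitSum f w = f [] w := by
  cases w with
  | nil => rfl
  | cons x w =>
    rw [splitSum, splitSum_congr (g := fun _ _ => 0) fun u v _ => hf _ _ (by simp), splitSum_zero,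
      add_zero]

theorem splitSum_eq_sum_range (f : List α → List α → M) (w : List α) :
    splitSum f w = ∑ i ∈ range (w.length + 1), f (w.take i) (w.drop i) := by
  induction w generalizing f with
  | nil => simp [splitSum]
  | cons x w ih =>
    rw [splitSum, ih, List.length_cons, sum_range_succ' _ (w.length + 1), add_comm]
    rfl

/-- The sum of `f u v t` over all factorizations `w = u ++ v ++ t`. -/
def splitSum₃ (f : List α → List α → List α → M) (w : List α) : M :=
  splitSum (fun u r => splitSum (fun v t => f u v t) r) w

theorem splitSum₃_congr {f g : List α → List α → List α → M} {w : List α}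
    (hfg : ∀ u v t, u ++ v ++ t = w → f u v t = g u v t) : splitSum₃ f w = splitSum₃ g w :=
  splitSum_congr fun _ _ hr => splitSum_congr fun _ _ ht => hfg _ _ _ (by rw [← hr, ← ht]; simp)

theorem splitSum₃_add (f g : List α → List α → List α → M) (w : List α) :
    splitSum₃ (fun u v t => f u v t + g u v t) w = splitSum₃ f w + splitSum₃ g w := by
  simp only [splitSum₃, splitSum_add]

theorem splitSum₃_hom {F : Type*} [FunLike F M N] [AddMonoidHomClass F M N] (L : F)
    (f : List α → List α → List α → M) (w : List α) :
    splitSum₃ (fun u v t => L (f u v t)) w = L (splitSum₃ f w) := by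
  simp only [splitSum₃, splitSum_hom]

theorem splitSum₃_eq_sum (f : List α → List α → List α → M) (hf : ∀ u t, f u [] t = 0)
    (w : List α) :
    splitSum₃ f w = ∑ l ∈ Icc 1 w.length, ∑ i ∈ range (w.length + 1 - l),
      f (w.take i) ((w.drop i).take l) ((w.drop i).drop l) := by
  simp only [splitSum₃, splitSum_eq_sum_range, List.length_drop]
  rw [sum_comm' (t' := range (w.length + 1)) (s' := fun l => range (w.length + 1 - l))
    (by intro x y; simp only [mem_range]; omega), range_eq_Ico, sum_eq_sum_Ico_succ_bot (by omega)]
  simp only [List.take_zero, hf, sum_const_zero, zero_add]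
  rfl

/-- The sum of `f p` over all factorizations `w = b₁ ++ ⋯ ++ b_m` into nonempty words, where
`p = [b₁, …, b_m]`. A factorization of `x :: w` arises from one of `w` by adjoining `x` to the first
factor or by making `x` a factor of its own. -/
def blockSum (f : List (List α) → M) : List α → M
  | [] => f []
  | x :: w => blockSum (fun p => match p with
    | [] => f [[x]]
    | b :: p => f ((x :: b) :: p) + f ([x] :: b :: p)) w

theorem blockSum_add (f g : List (List α) → M) (w : List α) :
    blockSum (fun p => f p + g p) w = blockSum f w + blockSum g w := by
  induction w generalizing f g with
  | nil => rfl
  | cons x w ih =>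
    simp only [blockSum, ← ih]
    congr 1; ext p; cases p
    · rfl
    · simp only; abel

theorem blockSum_hom {F : Type*} [FunLike F M N] [AddMonoidHomClass F M N] (L : F)
    (f : List (List α) → M) (w : List α) :
    blockSum (fun p => L (f p)) w = L (blockSum f w) := by
  induction w generalizing f with
  | nil => rfl
  | cons x w ih =>
    simp only [blockSum, ← ih]
    congr 1; ext p; cases p
    · rfl
    · simp only [map_add]

/-- Cutting a factorization into two consecutive pieces amounts to cutting the word and factorizing
both parts: this is the multiplicativity of the coalgebra map defined by a family of operations. -/
theorem blockSum_splitSum (f : List (List α) → List (List α) → M) (w : List α) :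
    blockSum (fun p => splitSum f p) w =
      splitSum (fun u v => blockSum (fun p₁ => blockSum (fun p₂ => f p₁ p₂) v) u) w := by
  induction w generalizing f with
  | nil => rfl
  | cons x w ih =>
    have key : ∀ f' : List (List α) → List (List α) → M, (∀ p₂, f' [] p₂ = f [[x]] p₂) →
        (∀ b p₁ p₂, f' (b :: p₁) p₂ = f ((x :: b) :: p₁) p₂ + f ([x] :: b :: p₁) p₂) →
        blockSum (fun p => splitSum f p) (x :: w) =
          blockSum (fun p₂ => f [] p₂) (x :: w) + blockSum (fun p => splitSum f' p) w := by
      intro f' h0 h1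
      simp only [blockSum, ← blockSum_add]
      congr 1; ext p; cases p with
      | nil => simp [splitSum, h0]
      | cons b p => simp only [splitSum, h0, h1, splitSum_add]; abel
    rw [key (fun p₁ p₂ => match p₁ with
      | [] => f [[x]] p₂
      | b :: p => f ((x :: b) :: p) p₂ + f ([x] :: b :: p) p₂) (fun _ => rfl) (fun _ _ _ => rfl),
      ih]
    simp only [splitSum]
    congr 1
    refine splitSum_congr fun u v _ => ?_
    simp only [blockSum]
    congr 1; ext p; cases p
    · rfl
    · simp only [blockSum_add]

theorem blockSum_congr {f g : List (List α) → M} {w : List α}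
    (hfg : ∀ p : List (List α), p.flatten = w → [] ∉ p → f p = g p) :
    blockSum f w = blockSum g w := by
  induction w generalizing f g with
  | nil => exact hfg [] rfl (by simp)
  | cons x w ih =>
    refine ih fun p hp hp' => ?_
    cases p with
    | nil => exact hfg _ (by simpa using hp) (by simp)
    | cons b p =>
      simp only [List.mem_cons, not_or] at hp'
      simp only
      rw [hfg _ (by simpa using hp) (by simp [hp'.2]),
        hfg _ (by simpa using hp) (by simp [hp'.1, hp'.2])]

end Words

/-! ### The convolution product and the differential on cochains of words -/

section Cochains
variable {k A B C α β : Type*} [Field k] [AddCommGroup A] [Module k A] [AddCommGroup B] [Module k B]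
  [AddCommGroup C] [Module k C]

/-- The convolution product `(a * b)(w) = ∑ m (a u) (b v)` over `w = u ++ v` of functions of words
with values in a space with a bilinear operation `m`. -/
def conv (m : A →ₗ[k] A →ₗ[k] A) :
    (List α → A) →ₗ[k] (List α → A) →ₗ[k] (List α → A) :=
  LinearMap.mk₂ k (fun a b w => splitSum (fun u v => m (a u) (b v)) w)
    (fun a a' b => by ext w; simp [splitSum_add])
    (fun c a b => by
      ext w; simp only [Pi.smul_apply, map_smul, LinearMap.smul_apply]
      exact splitSum_hom (DistribSMul.toAddMonoidHom A c) _ w)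
    (fun a b b' => by ext w; simp [splitSum_add])
    (fun c a b => by
      ext w; simp only [Pi.smul_apply, map_smul]
      exact splitSum_hom (DistribSMul.toAddMonoidHom A c) _ w)

theorem conv_apply (m : A →ₗ[k] A →ₗ[k] A) (a b : List α → A) (w : List α) :
    conv m a b w = splitSum (fun u v => m (a u) (b v)) w := rfl

/-- The dual of the coderivation of the words in `α` with components `b`, where `s` is the
grading involution: `(D a)(w) = ∑ a (s u ++ b v ++ t)` over `w = u ++ v ++ t`. -/
def coder (s : α → α) (b : List α → α) : (List α → A) →ₗ[k] (List α → A) where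
  toFun a w := splitSum₃ (fun u v t => a (u.map s ++ b v :: t)) w
  map_add' a a' := by ext w; simp [splitSum₃_add]
  map_smul' c a := by
    ext w; exact splitSum₃_hom (DistribSMul.toAddMonoidHom A c) _ w

theorem coder_apply (s : α → α) (b : List α → α) (a : List α → A) (w : List α) :
    coder (k := k) s b a w = splitSum₃ (fun u v t => a (u.map s ++ b v :: t)) w := rfl

theorem coder_comp (s : α → α) (b : List α → α) (L : A →ₗ[k] B) (a : List α → A) :
    coder (k := k) s b (L ∘ a) = L ∘ coder (k := k) s b a := by
  ext w; exact splitSum₃_hom L _ w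

theorem coder_conv (m : A →ₗ[k] A →ₗ[k] A) (s : α → α) (b : List α → α) (a a' : List α → A) :
    coder (k := k) s b (conv m a a') =
      conv m (coder (k := k) s b a) a' + conv m (a ∘ List.map s) (coder (k := k) s b a') := by
  ext w
  simp only [coder_apply, conv_apply, splitSum₃, splitSum_append_cons, splitSum_add, splitSum_map,
    Pi.add_apply]
  rw [add_comm]
  congr 1
  · -- the cut lies in `t`
    have h1 : ∀ u r : List α, splitSum (fun v t => splitSum (fun t₁ t₂ =>
          m (a (u.map s ++ b v :: t₁)) (a' t₂)) t) r =
        splitSum (fun q t₂ => splitSum (fun v t₁ => m (a (u.map s ++ b v :: t₁)) (a' t₂)) q) r :=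
      fun u r => (splitSum_assoc _ _).symm
    refine (splitSum_congr fun u r _ => h1 u r).trans ?_
    rw [← splitSum_assoc (fun u q t₂ => splitSum (fun v t₁ =>
      m (a (u.map s ++ b v :: t₁)) (a' t₂)) q)]
    refine splitSum_congr fun p t₂ _ => ?_
    have := fun x => splitSum_hom (α := α) (m.flip (a' t₂)) x
    simp only [LinearMap.flip_apply] at this
    simp only [this]
  · -- the cut lies in `u`
    have h1 : ∀ u r : List α, splitSum (fun v t => splitSum (fun u₁ u₂ =>
          m (a (u₁.map s)) (a' (u₂.map s ++ b v :: t))) u) r =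
        splitSum (fun u₁ u₂ => splitSum (fun v t =>
          m (a (u₁.map s)) (a' (u₂.map s ++ b v :: t))) r) u :=
      fun u r => splitSum_comm _ _ _
    refine (splitSum_congr fun u r _ => h1 u r).trans ?_
    rw [splitSum_assoc (fun u₁ u₂ r => splitSum (fun v t =>
          m (a (u₁.map s)) (a' (u₂.map s ++ b v :: t))) r)]
    simp only [splitSum_hom, Function.comp_apply]

/-- The projection to the words of length one. -/
def proj : List A → A
  | [x] => x
  | _ => 0

theorem proj_eq_zero {w : List A} (hw : w.length ≠ 1) : proj w = 0 := by
  match w, hw with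
  | [], _ => rfl
  | _ :: _ :: _, _ => rfl

theorem coder_proj (s : A → A) (b : List A → A) : coder (k := k) s b proj = b := by
  ext w
  rw [coder_apply, splitSum₃, splitSum_eq_right, splitSum_eq_left]
  · rfl
  · intro u v hv
    exact proj_eq_zero (by simpa using hv)
  · intro u v hu
    rw [splitSum_congr (g := fun _ _ => 0), splitSum_zero]
    intro v t _
    refine proj_eq_zero ?_
    have := List.length_pos_iff.2 hu
    simp; omega

theorem proj_map (L : A →ₗ[k] B) (w : List A) : proj (w.map L) = L (proj w) := by
  match w with
  | [] => exact (map_zero L).symm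
  | [x] => rfl
  | _ :: _ :: _ => exact (map_zero L).symm

/-- Precomposition of a function of words with the coalgebra map with components `F`:
`w ↦ ∑ a [F b₁, …, F b_m]` over `w = b₁ ++ ⋯ ++ b_m`. -/
def subst (F : List α → β) (a : List β → A) (w : List α) : A :=
  blockSum (fun p => a (p.map F)) w

theorem subst_conv (m : A →ₗ[k] A →ₗ[k] A) (F : List α → β) (a a' : List β → A) :
    subst F (conv m a a') = conv m (subst F a) (subst F a') := by
  ext w
  simp only [subst, conv_apply, splitSum_map, blockSum_splitSum]
  refine splitSum_congr fun u v _ => ?_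
  simp only [blockSum_hom]
  exact blockSum_hom (m.flip _) _ _

theorem subst_comp (F : List α → β) (L : A →ₗ[k] C) (a : List β → A) :
    subst F (L ∘ a) = L ∘ subst F a := by
  ext w; exact blockSum_hom L _ w

theorem subst_sub (F : List α → β) (a a' : List β → A) :
    subst F (a - a') = subst F a - subst F a' := by
  rw [eq_sub_iff_add_eq]
  ext w
  simp only [subst, Pi.add_apply, ← blockSum_add]
  simp

theorem subst_proj (F : List α → B) (hF : F [] = 0) : subst F proj = F := by
  ext w
  -- `S` splits off the first factor of a factorization of `w`
  have key : ∀ (w : List α) (S : List α → B),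
      blockSum (fun p => match p with | [b] => S b | _ => 0) w = if w = [] then 0 else S w := by
    intro w
    induction w with
    | nil => intro S; rfl
    | cons x w ih =>
      intro S
      have : (fun p : List (List α) => (match p with
          | [] => (match ([[x]] : List (List α)) with | [b] => S b | _ => 0)
          | b :: p => (match (x :: b) :: p with | [b] => S b | _ => 0) +
            (match [x] :: b :: p with | [b] => S b | _ => 0) : B)) =
          fun p => (match p with | [] => S [x] | _ => 0) +
            (match p with | [b] => S (x :: b) | _ => 0) := by
        ext p
        match p with
        | [] => simp
        | [b] => simp
        | b :: b' :: p => simp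
      rw [blockSum]
      refine (congrArg (fun f => blockSum f w) this).trans ?_
      rw [blockSum_add, ih (fun b => S (x :: b))]
      cases w with
      | nil => simp [blockSum]
      | cons y w =>
        rw [blockSum_congr (g := fun _ => 0)]
        · have := blockSum_hom (α := α) (0 : B →+ B) (fun _ => 0) (y :: w)
          simp at this
          simp [this]
        · intro p hp _
          cases p with
          | nil => simp at hp
          | cons => rfl
  have := key w F
  rw [subst]
  refine (blockSum_congr (g := _) ?_).trans (this.trans ?_)
  · intro p _ _
    match p with
    | [] => rfl
    | [b] => rfl
    | _ :: _ :: _ => rfl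
  · split_ifs with h
    · rw [h, hF]
    · rfl

end Cochains

/-! ### Twisting cochains and homotopy transfer -/

section Twisting
variable {k A B α : Type*} [Field k] [AddCommGroup A] [Module k A] [AddCommGroup B] [Module k B]

/-- Composition of a function of words with a linear map. -/
abbrev post (L : A →ₗ[k] B) : (List α → A) →ₗ[k] (List α → B) := L.compLeft (List α)

/-- A dg-algebra in the signs of the bar construction: `σ` is the grading involution of the
suspension, and the differential `d` and the product `m` both have degree one, so that they
anticommute with `σ` and the Leibniz rule and associativity pick up Koszul signs. -/
structure BarAlgebra (d σ : A →ₗ[k] A) (m : A →ₗ[k] A →ₗ[k] A) : Prop where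
  invol : ∀ x, σ (σ x) = x
  d_invol : ∀ x, d (σ x) = -σ (d x)
  invol_mul : ∀ x y, σ (m x y) = -m (σ x) (σ y)
  leibniz : ∀ x y, d (m x y) = -m (d x) y - m (σ x) (d y)
  assoc : ∀ x y z, m (m x y) z = -m (σ x) (m y z)

theorem coder_post (s : α → α) (b : List α → α) (L : A →ₗ[k] B) (a : List α → A) :
    coder (k := k) s b (post L a) = post L (coder (k := k) s b a) := coder_comp s b L a

namespace BarAlgebra
variable {d σ : A →ₗ[k] A} {m : A →ₗ[k] A →ₗ[k] A} (hA : BarAlgebra d σ m)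
include hA

theorem post_invol (a : List α → A) : post σ (post σ a) = a := funext fun _ => hA.invol _

theorem post_d_invol (a : List α → A) : post d (post σ a) = -post σ (post d a) :=
  funext fun _ => hA.d_invol _

theorem post_invol_conv (a b : List α → A) :
    post σ (conv m a b) = -conv m (post σ a) (post σ b) := by
  ext w
  simp only [post, LinearMap.compLeft_apply, Function.comp_apply, Pi.neg_apply, conv_apply,
    ← splitSum_hom, hA.invol_mul]
  exact splitSum_hom (-AddMonoidHom.id A) _ w

theorem post_d_conv (a b : List α → A) :
    post d (conv m a b) = -conv m (post d a) b - conv m (post σ a) (post d b) := by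
  ext w
  simp only [post, LinearMap.compLeft_apply, Function.comp_apply, Pi.neg_apply, conv_apply,
    ← splitSum_hom, hA.leibniz, Pi.sub_apply, sub_eq_add_neg, splitSum_add]
  congr 1
  · exact splitSum_hom (-AddMonoidHom.id A) _ w
  · exact splitSum_hom (-AddMonoidHom.id A) _ w

theorem conv_assoc (a b c : List α → A) :
    conv m (conv m a b) c = -conv m (post σ a) (conv m b c) := by
  ext w
  have h1 : ∀ u v : List α, m (conv m a b u) (c v) =
      splitSum (fun u₁ u₂ => m (m (a u₁) (b u₂)) (c v)) u :=
    fun u v => (splitSum_hom (m.flip (c v)) _ u).symm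
  rw [conv_apply, splitSum_congr fun u v _ => h1 u v, splitSum_assoc
    (fun u₁ u₂ v => m (m (a u₁) (b u₂)) (c v))]
  simp only [hA.assoc]
  simp only [Pi.neg_apply, conv_apply, ← splitSum_hom]
  refine Eq.trans ?_ (splitSum_hom (-AddMonoidHom.id A) _ w)
  refine splitSum_congr fun u v _ => ?_
  exact splitSum_hom (-AddMonoidHom.id A) _ v

/-- The Bianchi identity for the Maurer–Cartan defect `E = d K + K * K - D K` of an even cochain
`K`, with `(d + D) (K * K)` on the left because this is the term to which the transfer formulas
apply `h`. The cubic terms in `K` cancel by associativity. -/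
theorem bianchi {s : α → α} {b : List α → α} {K : List α → A}
    (hK : ∀ w, K (w.map s) = σ (K w)) {E : List α → A}
    (hE : E = post d K + conv m K K - coder (k := k) s b K) :
    post d (conv m K K) + coder (k := k) s b (conv m K K) =
      -conv m E K - conv m (post σ K) E := by
  have hK' : K ∘ List.map s = post σ K := funext hK
  have h := hA.conv_assoc K K K
  rw [hA.post_d_conv, coder_conv, hK', hE]
  simp only [map_add, map_sub, LinearMap.add_apply, LinearMap.sub_apply, h]
  abel

end BarAlgebra

/-- Induction on the length of words. The hypothesis also covers the empty word. -/
theorem eq_zero_of_shorter {E : List α → A}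
    (h : ∀ w, (∀ u : List α, u.length < w.length → E u = 0) → E w = 0) : E = 0 := by
  ext w
  induction hn : w.length using Nat.strong_induction_on generalizing w with
  | _ n ih =>
    subst hn
    exact h w fun u hu => ih _ hu u rfl

theorem conv_left_eq_zero {m : A →ₗ[k] A →ₗ[k] A} {a b : List α → A} {w : List α} (hb : b [] = 0)
    (ha : ∀ u : List α, u.length < w.length → a u = 0) : conv m a b w = 0 := by
  rw [conv_apply, splitSum_congr (g := fun _ _ => 0), splitSum_zero]
  intro u v huv
  rcases v with _ | ⟨y, v⟩
  · rw [hb, map_zero]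
  · rw [ha u (by rw [← huv]; simp), map_zero, LinearMap.zero_apply]

theorem conv_right_eq_zero {m : A →ₗ[k] A →ₗ[k] A} {a b : List α → A} {w : List α} (ha : a [] = 0)
    (hb : ∀ u : List α, u.length < w.length → b u = 0) : conv m a b w = 0 := by
  rw [conv_apply, splitSum_congr (g := fun _ _ => 0), splitSum_zero]
  intro u v huv
  rcases u with _ | ⟨y, u⟩
  · rw [ha, map_zero, LinearMap.zero_apply]
  · rw [hb v (by rw [← huv]; simp), map_zero]

/-- The transferred morphism `G = g - h (G * G)` is a twisting cochain for the coderivation with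
components `d + f (G * G)`: by the Bianchi identity its defect `E` satisfies
`E = -h (E * G + σ G * E)`. -/
theorem maurerCartan_transfer {d σ h : A →ₗ[k] A} {m : A →ₗ[k] A →ₗ[k] A}
    (hA : BarAlgebra d σ m) {dB s : B →ₗ[k] B} {f : A →ₗ[k] B} {g : B →ₗ[k] A}
    (hg : ∀ y, g (dB y) = d (g y)) (hh : ∀ x, h (d x) + d (h x) = x - g (f x))
    {G : List B → A} {b : List B → B}
    (hG : G = post g proj - post h (conv m G G)) (hG0 : G [] = 0)
    (hGs : ∀ w, G (w.map s) = σ (G w))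
    (hb : b = post dB proj + post f (conv m G G)) :
    post d G + conv m G G - coder (k := k) s b G = 0 := by
  set E := post d G + conv m G G - coder (k := k) s b G with hE
  have key : E = post h (-conv m E G - conv m (post σ G) E) := by
    rw [← hA.bianchi hGs hE, map_add]
    have h1 : post d G = post g (post dB proj) -
        (conv m G G - post g (post f (conv m G G)) - post h (post d (conv m G G))) := by
      conv_lhs => rw [hG, map_sub]
      congr 1
      · ext w; exact (hg _).symm
      · ext w
        have := hh (conv m G G w)
        simp only [post, LinearMap.compLeft_apply, Function.comp_apply, Pi.sub_apply]
        rw [← this]; abel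
    have h2 : coder (k := k) s b G = post g b - post h (coder (k := k) s b (conv m G G)) := by
      conv_lhs => rw [hG, map_sub, coder_post, coder_post, coder_proj]
    conv_lhs => rw [hE, h1, h2, hb, map_add]
    rw [← hb]
    abel
  refine eq_zero_of_shorter fun w hw => ?_
  rw [key]
  simp only [post, LinearMap.compLeft_apply, Function.comp_apply, Pi.sub_apply, Pi.neg_apply]
  rw [conv_left_eq_zero hG0 hw, conv_right_eq_zero (by simp [hG0]) hw]
  simp

/-- The quadratic relations of the transferred products. -/
theorem transferred_relation {d σ h : A →ₗ[k] A} {m : A →ₗ[k] A →ₗ[k] A}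
    (hA : BarAlgebra d σ m) {dB s : B →ₗ[k] B} {f : A →ₗ[k] B} {g : B →ₗ[k] A}
    (hf : ∀ x, f (d x) = dB (f x))
    (hg : ∀ y, g (dB y) = d (g y)) (hh : ∀ x, h (d x) + d (h x) = x - g (f x))
    {G : List B → A} {b : List B → B}
    (hG : G = post g proj - post h (conv m G G)) (hG0 : G [] = 0)
    (hGs : ∀ w, G (w.map s) = σ (G w))
    (hb : b = post dB proj + post f (conv m G G)) :
    post dB (post f (conv m G G)) + coder (k := k) s b (post f (conv m G G)) = 0 := by
  have h1 : post dB (post f (conv m G G)) = post f (post d (conv m G G)) :=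
    funext fun w => (hf _).symm
  rw [h1, coder_post, ← map_add, hA.bianchi hGs rfl,
    maurerCartan_transfer hA hg hh hG hG0 hGs hb]
  simp

/-- The three structural identities of the `q`-kernel, proved simultaneously by induction on the
length of words: `f Q` is compatible with the codifferentials, `K` is a twisting cochain, and `h Q`
is a homotopy from the identity to `K`. -/
theorem qKernel_identities {d σ h p : A →ₗ[k] A} {m : A →ₗ[k] A →ₗ[k] A}
    (hA : BarAlgebra d σ m) (hp : ∀ x, p (d x) = d (p x))
    (hh : ∀ x, h (d x) + d (h x) = x - p x)
    {K Q H : List A → A} {b : List A → A}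
    (hb : b = post d proj + conv m proj proj)
    (hK : K = post p Q - post h (conv m K K))
    (hQ : Q = proj - conv m H proj - conv m (post σ K) H) (hH : H = post h Q)
    (hK0 : K [] = 0) (hH0 : H [] = 0)
    (hKs : ∀ w, K (w.map σ) = σ (K w)) (hHs : ∀ w, H (w.map σ) = -σ (H w)) :
    post d Q + conv m K K - coder (k := k) σ b Q = 0 ∧
      post d K + conv m K K - coder (k := k) σ b K = 0 ∧
      post d H + coder (k := k) σ b H - (Q - K) = 0 := by
  set R := post d Q + conv m K K - coder (k := k) σ b Q with hR
  set E := post d K + conv m K K - coder (k := k) σ b K with hE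
  set W := post d H + coder (k := k) σ b H - (Q - K) with hW
  have hhd : ∀ a : List A → A, post d (post h a) = a - post p a - post h (post d a) := fun a => by
    ext w
    have := hh (a w)
    simp only [post, LinearMap.compLeft_apply, Function.comp_apply, Pi.sub_apply]
    rw [← this]; abel
  have hpd : ∀ a : List A → A, post d (post p a) = post p (post d a) :=
    fun a => funext fun w => (hp _).symm
  have hWR : W = -post h R := by
    rw [hW, hR]
    have eK : post h (conv m K K) = post p Q - K := by
      conv_rhs => rw [hK]
      abel
    rw [hH, hhd, coder_post, map_sub, map_add, eK]
    abel
  have hER : E = post p R - post h (conv m E K + conv m (post σ K) E) := by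
    have h1 := hA.bianchi hKs hE
    have h2 : conv m E K + conv m (post σ K) E =
        -(post d (conv m K K) + coder (k := k) σ b (conv m K K)) := by rw [h1]; abel
    have h3 : coder (k := k) σ b K =
        post p (coder (k := k) σ b Q) - post h (coder (k := k) σ b (conv m K K)) := by
      conv_lhs => rw [hK, map_sub, coder_post, coder_post]
    have h4 : post d K = post p (post d Q) -
        (conv m K K - post p (conv m K K) - post h (post d (conv m K K))) := by
      conv_lhs => rw [hK, map_sub, hpd, hhd]
    rw [h2, hE, hR, h3, h4]
    simp only [map_add, map_sub, map_neg]
    abel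
  have hREW : R = conv m W proj + conv m K W - conv m (post σ E) H := by
    have hKs' : (post σ K : List A → A) ∘ List.map σ = K := by
      funext w
      simp only [post, LinearMap.compLeft_apply, Function.comp_apply, hKs, hA.invol]
    have hHs' : H ∘ List.map σ = -post σ H := funext hHs
    have eW : post d H = W + Q - K - coder (k := k) σ b H := by rw [hW]; abel
    have eE : post d K = E - conv m K K + coder (k := k) σ b K := by rw [hE]; abel
    -- the two ways of computing `Q * proj` and `K * Q`
    have a1 : conv m Q proj = conv m proj proj + conv m (post σ H) (conv m proj proj) +
        conv m K (conv m H proj) := by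
      conv_lhs => rw [hQ]
      simp only [map_sub, LinearMap.sub_apply, hA.conv_assoc, hA.post_invol]
      abel
    have a2 : conv m K Q = conv m K proj - conv m K (conv m H proj) -
        conv m K (conv m (post σ K) H) := by
      conv_lhs => rw [hQ]
      simp only [map_sub]
    have a3 : conv m (conv m (post σ K) (post σ K)) H = -conv m K (conv m (post σ K) H) := by
      rw [hA.conv_assoc, hA.post_invol]
    have h1 : post d Q = post d proj + conv m (post d H) proj + conv m (post σ H) (post d proj) -
        conv m (post σ (post d K)) H + conv m K (post d H) := by
      conv_lhs => rw [hQ]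
      simp only [map_sub, hA.post_d_conv, hA.post_d_invol, hA.post_invol, map_neg,
        LinearMap.neg_apply]
      abel
    have h2 : coder (k := k) σ b Q = b - conv m (coder (k := k) σ b H) proj +
        conv m (post σ H) b - conv m (post σ (coder (k := k) σ b K)) H -
        conv m K (coder (k := k) σ b H) := by
      conv_lhs => rw [hQ]
      simp only [map_sub, coder_conv, coder_post, coder_proj, hKs', hHs', map_neg,
        LinearMap.neg_apply]
      abel
    rw [hR, h1, h2, eW, eE]
    have eb : conv m proj proj = b - post d proj := by rw [hb]; abel
    simp only [map_add, map_sub, map_neg, LinearMap.add_apply, LinearMap.sub_apply,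
      LinearMap.neg_apply, a1, a2, hA.post_invol_conv, a3, eb]
    abel
  have main : ∀ n, ∀ w : List A, w.length = n → R w = 0 ∧ E w = 0 ∧ W w = 0 := by
    intro n
    induction n using Nat.strong_induction_on with
    | _ n ih =>
      intro w hn
      subst hn
      have r0 : R w = 0 := by
        rw [hREW]
        simp only [Pi.add_apply, Pi.sub_apply]
        rw [conv_left_eq_zero rfl fun u hu => (ih _ hu u rfl).2.2,
          conv_right_eq_zero hK0 fun u hu => (ih _ hu u rfl).2.2,
          conv_left_eq_zero hH0 fun u hu => by simp [(ih _ hu u rfl).2.1]]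
        simp
      refine ⟨r0, ?_, ?_⟩
      · rw [hER]
        simp only [post, LinearMap.compLeft_apply, Function.comp_apply, Pi.sub_apply,
          Pi.add_apply]
        rw [r0, conv_left_eq_zero hK0 fun u hu => (ih _ hu u rfl).2.1,
          conv_right_eq_zero (by simp [hK0]) fun u hu => (ih _ hu u rfl).2.1]
        simp
      · rw [hWR]
        simp [r0]
  exact ⟨funext fun w => (main _ w rfl).1, funext fun w => (main _ w rfl).2.1,
    funext fun w => (main _ w rfl).2.2⟩

end Twisting

/-! ### Operations as functions of words, and the décalage -/

section Words
variable {k A B C : Type*} [Field k] [AddCommGroup A] [Module k A] [AddCommGroup B] [Module k B]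
  [AddCommGroup C] [Module k C]

theorem neg_one_pow_eq_of_zmod {a b : ℕ} (h : (a : ZMod 2) = b) : (-1 : ℤ) ^ a = (-1) ^ b := by
  rw [← Nat.mod_add_div a 2, ← Nat.mod_add_div b 2, (ZMod.natCast_eq_natCast_iff' a b 2).1 h]
  simp [pow_add, pow_mul]

theorem neg_neg_one_pow_smul {M : Type*} [AddCommGroup M] (n : ℕ) (z : M) :
    -((-1 : ℤ) ^ n • z) = (-1 : ℤ) ^ (n + 1) • z := by
  rw [pow_succ]; simp

theorem zmod_two_eq_zero : (2 : ZMod 2) = 0 := rfl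

theorem add_choose_two (a b : ℕ) : (a + b).choose 2 = a.choose 2 + b.choose 2 + a * b := by
  induction b with
  | zero => simp
  | succ b ih =>
    rw [← add_assoc, Nat.choose_succ_succ' (a + b), Nat.choose_succ_succ' b, ih]
    simp; ring

/-- The value of a family of operations on a word, the operation being selected by the length. -/
def ev (φ : ∀ n, Op k A B n) (w : List A) : B := φ w.length w.get

theorem ev_eq (φ : ∀ n, Op k A B n) {n : ℕ} {x : Fin n → A} {w : List A} (hw : w.length = n)
    (hx : ∀ i (hi : i < n), x ⟨i, hi⟩ = w[i]) : φ n x = ev φ w := by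
  subst hw
  unfold ev
  congr 1
  ext i
  exact hx i i.2

theorem ev_ofFn (φ : ∀ n, Op k A B n) {n : ℕ} (x : Fin n → A) : ev φ (List.ofFn x) = φ n x :=
  (ev_eq φ (by simp) (by simp)).symm

theorem ev_eq_zero {φ : ∀ n, Op k A B n} {w : List A} (h : φ w.length = 0) : ev φ w = 0 := by
  rw [ev, h]; rfl

/-- The value on a word, as a linear function of one of its letters. -/
def evLinear (φ : ∀ n, Op k A B n) (u t : List A) : A →ₗ[k] B :=
  (φ (u.length + 1 + t.length)).toLinearMap (fun i => (u ++ 0 :: t)[i]'(by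
    have := i.2; simp; omega)) ⟨u.length, by omega⟩

theorem evLinear_apply (φ : ∀ n, Op k A B n) (u t : List A) (y : A) :
    evLinear φ u t y = ev φ (u ++ y :: t) := by
  refine ev_eq φ (by simp; omega) fun i hi => ?_
  rcases eq_or_ne i u.length with rfl | h
  · simp
  · rw [Function.update_of_ne (by simpa [Fin.ext_iff] using h)]
    simp only [Fin.getElem_fin, List.getElem_append]
    split_ifs with h1
    · rfl
    · obtain ⟨j, rfl⟩ : ∃ j, i = u.length + (j + 1) := ⟨i - u.length - 1, by omega⟩
      simp

theorem ev_map_neg (φ : ∀ n, Op k A B n) (γ : A →ₗ[k] A) (p u t : List A) :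
    ev φ (p ++ u.map (-γ) ++ t) = (-1 : ℤ) ^ u.length • ev φ (p ++ u.map γ ++ t) := by
  induction u generalizing p with
  | nil => simp
  | cons x u ih =>
    have h := ih (p ++ [(-γ) x])
    simp only [List.append_assoc, List.cons_append, List.nil_append, List.map_cons] at h ⊢
    rw [h, ← evLinear_apply, ← evLinear_apply, LinearMap.neg_apply, map_neg, List.length_cons,
      pow_succ]
    simp

/-- The sign twist `x₁ … x_n ↦ γ^{n-1} x₁ ⋯ γ x_{n-1} x_n` of a word. -/
def twist (γ : A →ₗ[k] A) : List A → List A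
  | [] => []
  | x :: w => (γ ^ w.length) x :: twist γ w

@[simp]
theorem length_twist (γ : A →ₗ[k] A) (w : List A) : (twist γ w).length = w.length := by
  induction w with
  | nil => rfl
  | cons x w ih => simp [twist, ih]

theorem map_pow_map_pow (γ : A →ₗ[k] A) (a b : ℕ) (w : List A) :
    (w.map (γ ^ a)).map (γ ^ b) = w.map (γ ^ (a + b)) := by
  rw [List.map_map]
  congr 1
  ext x
  rw [add_comm, pow_add]; rfl

theorem twist_append (γ : A →ₗ[k] A) (u v : List A) :
    twist γ (u ++ v) = (twist γ u).map (γ ^ v.length) ++ twist γ v := by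
  induction u with
  | nil => rfl
  | cons x u ih =>
    simp only [List.cons_append, twist, ih, List.map_cons, List.length_append]
    rw [add_comm, pow_add]; rfl

theorem twist_map (γ s : A →ₗ[k] A) (hs : ∀ x, γ (s x) = s (γ x)) (w : List A) :
    twist γ (w.map s) = (twist γ w).map s := by
  induction w with
  | nil => rfl
  | cons x w ih =>
    simp only [List.map_cons, twist, ih, List.length_map]
    congr 1
    have : ∀ n y, (γ ^ n) (s y) = s ((γ ^ n) y) := by
      intro n
      induction n with
      | zero => simp
      | succ n ih => intro y; rw [pow_succ]; simp only [Module.End.mul_apply, hs, ih]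
    exact this _ _

theorem pow_eq_of_zmod {γ : A →ₗ[k] A} (hγ : ∀ x, γ (γ x) = x) {a b : ℕ}
    (h : (a : ZMod 2) = b) : γ ^ a = γ ^ b := by
  have h2 : γ ^ 2 = 1 := by ext x; exact hγ x
  rw [← Nat.mod_add_div a 2, ← Nat.mod_add_div b 2, (ZMod.natCast_eq_natCast_iff' a b 2).1 h]
  simp [pow_add, pow_mul, h2]

theorem twist_twist {γ : A →ₗ[k] A} (hγ : ∀ x, γ (γ x) = x) (w : List A) :
    twist γ (twist γ w) = w := by
  induction w with
  | nil => rfl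
  | cons x w ih =>
    simp only [twist, ih, length_twist]
    congr 1
    rw [← Module.End.mul_apply, ← pow_add, pow_eq_of_zmod hγ (b := 0), pow_zero]
    · rfl
    · push_cast; linear_combination (w.length : ZMod 2) * zmod_two_eq_zero

/-- The function of words corresponding to a family of operations in the bar construction. The sign
`(-1)^{n(n-1)/2}` absorbs the signs `(-1)^{ab}` with which operations of arities `a` and `b` are
multiplied in the kernels and in the exponent `θ`, as `n(n-1)/2` is additive in `n = a + b` up to
`ab`. -/
def bar (γ : A →ₗ[k] A) (φ : ∀ n, Op k A B n) (w : List A) : B :=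
  (-1 : ℤ) ^ w.length.choose 2 • ev φ (twist γ w)

theorem ev_twist (γ : A →ₗ[k] A) (φ : ∀ n, Op k A B n) (w : List A) :
    ev φ (twist γ w) = (-1 : ℤ) ^ w.length.choose 2 • bar γ φ w := by
  rw [bar, smul_smul, ← pow_add, neg_one_pow_eq_of_zmod (b := 0), pow_zero, one_smul]
  push_cast; linear_combination (w.length.choose 2 : ZMod 2) * zmod_two_eq_zero

theorem bar_nil (γ : A →ₗ[k] A) (φ : ∀ n, Op k A B n) (h : φ 0 = 0) : bar γ φ [] = 0 := by
  rw [bar, ev_eq_zero h, smul_zero]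

theorem bar_append_cons (γ : A →ₗ[k] A) (φ : ∀ n, Op k A B n) (u t : List A) (y : A) :
    bar γ φ (u ++ y :: t) = (-1 : ℤ) ^ (u.length + 1 + t.length).choose 2 •
      evLinear φ ((twist γ u).map (γ ^ (t.length + 1))) (twist γ t) ((γ ^ t.length) y) := by
  rw [bar, twist_append, evLinear_apply]
  simp only [twist, List.length_append, List.length_cons]
  rw [add_assoc, add_comm 1]

/-- Every function of words coming from operations is additive in each letter. -/
theorem bar_append_cons_sub (γ : A →ₗ[k] A) (φ : ∀ n, Op k A B n) (u t : List A) (y z : A) :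
    bar γ φ (u ++ (y - z) :: t) = bar γ φ (u ++ y :: t) - bar γ φ (u ++ z :: t) := by
  simp only [bar_append_cons, map_sub, smul_sub]

theorem bar_append_cons_zero (γ : A →ₗ[k] A) (φ : ∀ n, Op k A B n) (u t : List A) :
    bar γ φ (u ++ 0 :: t) = 0 := by
  simp only [bar_append_cons, map_zero, smul_zero]

theorem coder_bar_sub (γ : A →ₗ[k] A) (s : A → A) (φ : ∀ n, Op k A B n) (b b' : List A → A)
    (w : List A) :
    coder (k := k) s (b - b') (bar γ φ) w =
      splitSum₃ (fun u v t => bar γ φ (u.map s ++ b v :: t)) w -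
        splitSum₃ (fun u v t => bar γ φ (u.map s ++ b' v :: t)) w := by
  rw [coder_apply, eq_sub_iff_add_eq, ← splitSum₃_add]
  refine splitSum₃_congr fun u v t _ => ?_
  rw [Pi.sub_apply, bar_append_cons_sub, sub_add_cancel]

/-- A family of operations of degree `e n` mod `2` in arity `n`, expressed by grading
involutions. -/
def HasParity (γ : A →ₗ[k] A) (γ' : B →ₗ[k] B) (φ : ∀ n, Op k A B n) (e : ℕ → ℕ) : Prop :=
  ∀ n (x : Fin n → A), γ' (φ n x) = (-1 : ℤ) ^ e n • φ n fun i => γ (x i)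

theorem HasParity.ev_map {γ : A →ₗ[k] A} {γ' : B →ₗ[k] B} {φ : ∀ n, Op k A B n} {e : ℕ → ℕ}
    (h : HasParity γ γ' φ e) (w : List A) :
    ev φ (w.map γ) = (-1 : ℤ) ^ e w.length • γ' (ev φ w) := by
  rw [ev, ev, h, smul_smul, ← pow_add, ← two_mul, pow_mul]
  simp only [even_two, Even.neg_pow, one_pow, one_smul]
  exact (ev_eq φ (by simp) (by simp)).symm

theorem HasParity.ev_map_pow {γ : A →ₗ[k] A} {γ' : B →ₗ[k] B} {φ : ∀ n, Op k A B n} {e : ℕ → ℕ}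
    (h : HasParity γ γ' φ e) (w : List A) (j : ℕ) :
    ev φ (w.map (γ ^ j)) = (-1 : ℤ) ^ (j * e w.length) • (γ' ^ j) (ev φ w) := by
  induction j with
  | zero => simp [Module.End.one_eq_id]
  | succ j ih =>
    rw [← map_pow_map_pow γ j 1, pow_one, h.ev_map, ih, List.length_map, map_zsmul, smul_smul,
      ← pow_add, pow_succ' γ']
    congr 2
    ring

theorem bar_map_neg (γ : A →ₗ[k] A) (w : List A) (φ : ∀ n, Op k A B n) :
    bar γ φ (w.map (-γ)) =
      (-1 : ℤ) ^ (w.length.choose 2 + w.length) • ev φ ((twist γ w).map γ) := by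
  have := ev_map_neg φ γ [] (twist γ w) []
  simp only [List.nil_append, List.append_nil, length_twist] at this
  rw [bar, twist_map γ _ (by simp), this, smul_smul, pow_add, List.length_map]

/-- Operations of degree `1 - n` become even in the bar construction. -/
theorem HasParity.bar_even {γ : A →ₗ[k] A} {γ' : B →ₗ[k] B} {φ : ∀ n, Op k A B n}
    (h : HasParity γ γ' φ fun n => n + 1) (w : List A) :
    bar γ φ (w.map (-γ)) = (-γ') (bar γ φ w) := by
  rw [bar_map_neg, h.ev_map, bar, smul_smul, ← pow_add, LinearMap.neg_apply, map_zsmul,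
    length_twist, neg_one_pow_eq_of_zmod (b := w.length.choose 2 + 1)]
  · rw [pow_succ]; simp
  · push_cast; linear_combination (w.length : ZMod 2) * zmod_two_eq_zero

/-- Operations of degree `-n` become odd in the bar construction. -/
theorem HasParity.bar_odd {γ : A →ₗ[k] A} {γ' : B →ₗ[k] B} {φ : ∀ n, Op k A B n}
    (h : HasParity γ γ' φ fun n => n) (w : List A) :
    bar γ φ (w.map (-γ)) = -(-γ') (bar γ φ w) := by
  rw [bar_map_neg, h.ev_map, bar, smul_smul, ← pow_add, LinearMap.neg_apply, map_zsmul, neg_neg,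
    length_twist, neg_one_pow_eq_of_zmod (b := w.length.choose 2)]
  · push_cast; linear_combination (w.length : ZMod 2) * zmod_two_eq_zero

/-! ### Products of operations as convolutions -/

theorem mulTensor_eq_ev (γ : A →ₗ[k] A) (μ : A →ₗ[k] A →ₗ[k] A) {a b n : ℕ} (hn : a + b = n)
    (φ ψ : ∀ n, Op k A A n) (e : ℕ) {x : Fin n → A} {u v : List A} (hu : u.length = a)
    (hv : v.length = b) (hx : List.ofFn x = u ++ v) :
    mulTensor γ μ hn (φ a) (ψ b) e x = μ (ev φ (u.map (γ ^ e))) (ev ψ v) := by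
  have hx' : ∀ i (hi : i < n), x ⟨i, hi⟩ = (u ++ v)[i]'(by simp; omega) := by
    intro i hi; simp [← hx]
  rw [mulTensor_apply]
  refine congrArg₂ (fun y z => μ y z) ?_ ?_
  · refine ev_eq φ (by simpa using hu) fun i hi => ?_
    rw [List.getElem_map, finCongr_apply]
    congr 1
    refine (hx' i (by omega)).trans ?_
    exact List.getElem_append_left (by omega)
  · refine ev_eq ψ hv fun i hi => ?_
    refine (hx' (a + i) (by omega)).trans ?_
    rw [List.getElem_append_right (by omega)]
    simp [hu]

/-- The tensor product sign for a second factor of degree `1 - b` is the one of the bar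
construction, up to the sign with which the kernels are defined. -/
theorem mulTensor_eq_bar_shift {γ : A →ₗ[k] A} (hγ : ∀ x, γ (γ x) = x) (μ : A →ₗ[k] A →ₗ[k] A)
    {a b n : ℕ} (hn : a + b = n) (φ ψ : ∀ n, Op k A A n) {e : ℕ} (he : (e : ZMod 2) = b + 1)
    {x : Fin n → A} {u v : List A} (hu : u.length = a) (hv : v.length = b)
    (hx : List.ofFn x = twist γ (u ++ v)) :
    (-1 : ℤ) ^ (n.choose 2 + a * (b + 1)) • mulTensor γ μ hn (φ a) (ψ b) e x =
      μ (bar γ φ (u.map (-γ))) (bar γ ψ v) := by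
  rw [mulTensor_eq_ev γ μ hn φ ψ e (by simpa using hu) (by simpa using hv)
    (hx.trans (twist_append γ u v)), map_pow_map_pow, bar_map_neg,
    pow_eq_of_zmod hγ (b := 1), pow_one, bar]
  · simp only [map_zsmul, LinearMap.smul_apply, smul_smul, ← pow_add, hu, hv]
    congr 1
    refine neg_one_pow_eq_of_zmod ?_
    rw [← hn, add_choose_two]
    push_cast; linear_combination ((a : ZMod 2) * b) * zmod_two_eq_zero
  · push_cast; rw [he, hv]; linear_combination (b : ZMod 2) * zmod_two_eq_zero

/-- The same for a second factor of degree `-b`. -/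
theorem mulTensor_eq_bar {γ : A →ₗ[k] A} (hγ : ∀ x, γ (γ x) = x) (μ : A →ₗ[k] A →ₗ[k] A)
    {a b n : ℕ} (hn : a + b = n) (φ ψ : ∀ n, Op k A A n) {e : ℕ} (he : (e : ZMod 2) = b)
    {x : Fin n → A} {u v : List A} (hu : u.length = a) (hv : v.length = b)
    (hx : List.ofFn x = twist γ (u ++ v)) :
    (-1 : ℤ) ^ (n.choose 2 + a * b) • mulTensor γ μ hn (φ a) (ψ b) e x =
      μ (bar γ φ u) (bar γ ψ v) := by
  rw [mulTensor_eq_ev γ μ hn φ ψ e (by simpa using hu) (by simpa using hv)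
    (hx.trans (twist_append γ u v)), map_pow_map_pow,
    pow_eq_of_zmod hγ (b := 0), pow_zero, bar, bar]
  · simp only [map_zsmul, LinearMap.smul_apply, smul_smul, ← pow_add, hu, hv, Module.End.one_eq_id,
      LinearMap.id_coe, List.map_id]
    congr 1
    refine neg_one_pow_eq_of_zmod ?_
    rw [← hn, add_choose_two]
    push_cast; linear_combination ((a : ZMod 2) * b) * zmod_two_eq_zero
  · push_cast; rw [he, hv]; linear_combination (b : ZMod 2) * zmod_two_eq_zero

/-! ### Insertions of operations as coderivations -/

theorem insertAt_eq_ev (γ : A →ₗ[k] A) (φ : ∀ n, Op k A B n) (ψ : ∀ n, Op k A A n) {r i l n : ℕ}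
    (e : ℕ) {x : Fin n → A} {u v t : List A} (hu : u.length = i) (hv : v.length = l) (hl : 1 ≤ l)
    (ht : i + 1 + t.length = r) (hx : List.ofFn x = u ++ v ++ t) :
    insertAt γ (φ r) i (ψ l) e x = ev φ (u.map (γ ^ e) ++ ev ψ v :: t) := by
  have hn : n = u.length + v.length + t.length := by
    simpa [add_assoc] using congrArg List.length hx
  have hx' : ∀ j (hj : j < u.length + v.length + t.length),
      entry x j = (u ++ v ++ t)[j]'(by simp; omega) := by
    intro j hj; simp [← hx, entry, hn, hj]
  unfold insertAt
  refine ev_eq φ (by simp; omega) fun j hj => ?_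
  simp only
  split_ifs with h1 h2
  · rw [List.getElem_append_left (by simp; omega), hx' _ (by omega), List.getElem_map]
    simp [hu, h1]
  · subst h2
    simp only [← hu]
    rw [List.getElem_append_right (by simp)]
    simp only [List.length_map, Nat.sub_self, List.getElem_cons_zero]
    refine ev_eq ψ hv fun m hm => ?_
    rw [hx' _ (by omega)]
    simp [hv, hm]
  · obtain ⟨m, rfl⟩ : ∃ m, j = i + (m + 1) := ⟨j - i - 1, by omega⟩
    rw [hx' _ (by omega), List.getElem_append_right (by simp; omega),
      List.getElem_append_right (by simp; omega)]
    simp only [List.length_map, hu, Nat.add_sub_cancel_left, List.getElem_cons_succ,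
      List.length_append]
    congr 1
    omega

/-- Insertion of an operation of degree `2 - l` becomes, in the bar construction, insertion without
further signs than the Koszul sign of an odd operation. -/
theorem insertAt_eq_bar {γ : A →ₗ[k] A} (hγ : ∀ x, γ (γ x) = x) (φ : ∀ n, Op k A B n)
    {ψ : ∀ n, Op k A A n} (hψ : HasParity γ γ ψ fun n => n) {r i l n : ℕ} (hl : 1 ≤ l)
    {x : Fin n → A} {u v t : List A} (hu : u.length = i) (hv : v.length = l)
    (ht : i + 1 + t.length = r) (hx : List.ofFn x = twist γ (u ++ v ++ t)) :
    (-1 : ℤ) ^ (n.choose 2 + ((i + 1) * (l + 1) + n)) • insertAt γ (φ r) i (ψ l) l x =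
      -bar γ φ (u.map (-γ) ++ bar γ ψ v :: t) := by
  have hn : n = i + l + t.length := by
    have := congrArg List.length hx
    simp at this; omega
  rw [insertAt_eq_ev γ φ ψ l (u := (twist γ u).map (γ ^ (v.length + t.length)))
    (v := (twist γ v).map (γ ^ t.length)) (t := twist γ t) (by simpa using hu) (by simpa using hv)
    hl (by simpa using ht) (by
      rw [hx, twist_append, twist_append, List.map_append, map_pow_map_pow]),
    map_pow_map_pow, hψ.ev_map_pow, ev_twist, length_twist, bar_append_cons,
    twist_map γ _ (by simp), evLinear_apply,
    pow_eq_of_zmod hγ (a := v.length + t.length + l) (b := t.length)]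
  · have h1 := ev_map_neg φ (γ ^ (t.length + 2)) [] (twist γ u)
      ((γ ^ t.length) (bar γ ψ v) :: twist γ t)
    have h2 : ((twist γ u).map (-γ)).map (γ ^ (t.length + 1)) =
        (twist γ u).map (-(γ ^ (t.length + 2))) := by
      rw [List.map_map]
      congr 1
      ext x
      simp [pow_succ]
    simp only [List.nil_append, length_twist] at h1
    rw [h2, List.length_map, h1, ← evLinear_apply, ← evLinear_apply,
      pow_eq_of_zmod hγ (a := t.length + 2) (b := t.length), map_zsmul, map_zsmul, map_zsmul,
      smul_smul, smul_smul, smul_smul, ← pow_add, ← pow_add, ← pow_add,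
      neg_neg_one_pow_smul]
    · congr 1
      refine neg_one_pow_eq_of_zmod ?_
      rw [hn, hu, hv, add_assoc i l, add_assoc i 1, add_choose_two i, add_choose_two i,
        add_choose_two l, add_choose_two 1]
      simp only [Nat.choose_succ_self, zero_add]
      push_cast
      linear_combination ((l.choose 2 : ZMod 2) + l * t.length + i * l + l) * zmod_two_eq_zero
    · push_cast; linear_combination zmod_two_eq_zero
  · push_cast; rw [hv]; linear_combination (l : ZMod 2) * zmod_two_eq_zero

end Words

section Insertions
variable {k A B C : Type*} [Field k] [AddCommGroup A] [Module k A] [AddCommGroup B] [Module k B]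
  [AddCommGroup C] [Module k C]

theorem insertAt_zero (γ : A →ₗ[k] A) {r i l n : ℕ} (φ : Op k A B r) (hi : i < r) (e : ℕ)
    (x : Fin n → A) : insertAt γ φ i (0 : Op k A A l) e x = 0 := by
  rw [insertAt, φ.map_coord_zero ⟨i, hi⟩]
  simp

theorem sum_insertAt_one_eq_bar {γ : A →ₗ[k] A} (hγ : ∀ x, γ (γ x) = x) (φ : ∀ n, Op k A B n)
    {ψ : ∀ n, Op k A A n} (hψ : HasParity γ γ ψ fun n => n) (h0 : ψ 0 = 0) {n : ℕ}
    {x : Fin n → A} {w : List A} (hx : List.ofFn x = twist γ w) :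
    (-1 : ℤ) ^ n.choose 2 • ∑ l ∈ Icc 1 n, ∑ i ∈ range (n + 1 - l),
        (-1 : ℤ) ^ ((i + 1) * (l + 1) + n) • insertAt γ (φ (n + 1 - l)) i (ψ l) l x =
      -splitSum₃ (fun u v t => bar γ φ (u.map (-γ) ++ bar γ ψ v :: t)) w := by
  have hn : w.length = n := by simpa using (congrArg List.length hx).symm
  rw [splitSum₃_eq_sum _ (fun u t => by rw [bar_nil γ ψ h0, bar_append_cons_zero]), hn, smul_sum,
    ← sum_neg_distrib]
  refine sum_congr rfl fun l hl => ?_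
  rw [smul_sum, ← sum_neg_distrib]
  refine sum_congr rfl fun i hi => ?_
  rw [mem_Icc] at hl
  rw [mem_range] at hi
  rw [smul_smul, ← pow_add]
  refine insertAt_eq_bar hγ φ hψ hl.1 (by simp; omega) (by simp; omega) (by simp; omega) ?_
  rw [hx, List.append_assoc, List.take_append_drop, List.take_append_drop]

theorem sum_insertAt_eq_bar {γ : A →ₗ[k] A} (hγ : ∀ x, γ (γ x) = x) (φ : ∀ n, Op k A B n)
    {ψ : ∀ n, Op k A A n} (hψ : HasParity γ γ ψ fun n => n) (h0 : ψ 0 = 0) (h1 : ψ 1 = 0) {n : ℕ}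
    {x : Fin n → A} {w : List A} (hx : List.ofFn x = twist γ w) :
    (-1 : ℤ) ^ n.choose 2 • ∑ l ∈ Icc 2 n, ∑ i ∈ range (n + 1 - l),
        (-1 : ℤ) ^ ((i + 1) * (l + 1) + n) • insertAt γ (φ (n + 1 - l)) i (ψ l) l x =
      -splitSum₃ (fun u v t => bar γ φ (u.map (-γ) ++ bar γ ψ v :: t)) w := by
  rw [← sum_insertAt_one_eq_bar hγ φ hψ h0 hx]
  congr 1
  refine sum_subset (Icc_subset_Icc_left one_le_two) fun l hl hl' => sum_eq_zero fun i hi => ?_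
  obtain rfl : l = 1 := by simp only [mem_Icc] at hl hl'; omega
  rw [h1, insertAt_zero γ _ (mem_range.1 hi), smul_zero]

/-- A linear map as a family of operations concentrated in arity one. -/
def unaryFamily (d : A →ₗ[k] B) : ∀ n, Op k A B n
  | 1 => d.compMultilinearMap (idOp k A)
  | _ => 0

theorem bar_unaryFamily (γ : A →ₗ[k] A) (d : A →ₗ[k] B) (w : List A) :
    bar γ (unaryFamily d) w = d (proj w) := by
  match w with
  | [] => exact (bar_nil γ _ rfl).trans (map_zero d).symm
  | [x] => exact one_smul ℤ (d x)
  | x :: y :: w =>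
    refine Eq.trans ?_ (map_zero d).symm
    rw [bar, ev_eq_zero, smul_zero]
    rfl

theorem FilteredComplex.ext_of_homogeneous (X : FilteredComplex k A) {L L' : A →ₗ[k] B}
    (h : ∀ n, ∀ x ∈ X.gr n, L x = L' x) : L = L' := by
  ext x
  have hx : x ∈ ⨆ n, X.gr n := by rw [X.isInternal.submodule_iSup_eq_top]; trivial
  exact LinearMap.eqOn_span' (s := ⋃ n, (X.gr n : Set A))
    (fun y hy => by obtain ⟨n, hn⟩ := Set.mem_iUnion.1 hy; exact h n y hn)
    (by simpa [Submodule.iSup_eq_span] using hx)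

theorem FilteredComplex.invol_invol (X : FilteredComplex k A) (x : A) :
    X.invol (X.invol x) = x := by
  have : X.invol ∘ₗ X.invol = LinearMap.id := X.ext_of_homogeneous fun n x hx => by
    rw [LinearMap.comp_apply, X.invol_of_mem hx, map_zsmul, X.invol_of_mem hx, smul_smul,
      ← Units.val_mul]
    simp
  exact LinearMap.congr_fun this x

/-- A linear map of degree `e` commutes with the grading involutions up to `(-1)^e`. -/
theorem FilteredComplex.invol_map (X : FilteredComplex k A) (Y : FilteredComplex k B)
    {L : A →ₗ[k] B} (e : ℤ) (hL : ∀ n, ∀ x ∈ X.gr n, L x ∈ Y.gr (n + e)) (x : A) :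
    Y.invol (L x) = (e.negOnePow : ℤ) • L (X.invol x) := by
  have : Y.invol ∘ₗ L = (e.negOnePow : ℤ) • (L ∘ₗ X.invol) := X.ext_of_homogeneous fun n x hx => by
    rw [LinearMap.comp_apply, Y.invol_of_mem (hL n x hx), LinearMap.smul_apply,
      LinearMap.comp_apply, X.invol_of_mem hx, map_zsmul, smul_smul, ← Units.val_mul,
      Int.negOnePow_add, mul_comm]
  exact LinearMap.congr_fun this x

theorem FilteredComplex.invol_d (X : FilteredComplex k A) (x : A) :
    X.invol (X.d x) = -X.d (X.invol x) := by
  rw [X.invol_map X 1 X.d_mem]; simp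

theorem delta_eq_bar (X : FilteredComplex k A) (Y : FilteredComplex k B) (φ : ∀ n, Op k A B n)
    {n : ℕ} (e : ℕ) {x : Fin n → A} {w : List A} (hx : List.ofFn x = twist X.invol w) :
    (-1 : ℤ) ^ n.choose 2 • delta X Y (φ n) e x = Y.d (bar X.invol φ w) +
      (-1 : ℤ) ^ (n + e) •
        splitSum₃ (fun u v t => bar X.invol φ (u.map (-X.invol) ++ X.d (proj v) :: t)) w := by
  have hn : w.length = n := by simpa using (congrArg List.length hx).symm
  have hψ : HasParity X.invol X.invol (unaryFamily X.d) fun n => n := by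
    intro m x
    match m with
    | 0 => simp [unaryFamily]
    | 1 => simp [unaryFamily, idOp, X.invol_d]
    | m + 2 => simp [unaryFamily]
  have h := sum_insertAt_one_eq_bar X.invol_invol φ hψ rfl hx
  rw [delta, smul_sub, bar, map_zsmul, hn, ← hx, ev_ofFn, sub_eq_add_neg]
  congr 1
  simp only [bar_unaryFamily] at h
  rw [← neg_neg (splitSum₃ _ _), ← h]
  have hsum : ∑ l ∈ Icc 1 n, ∑ i ∈ range (n + 1 - l), (-1 : ℤ) ^ ((i + 1) * (l + 1) + n) •
      insertAt X.invol (φ (n + 1 - l)) i (unaryFamily X.d l) l x =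
      (-1 : ℤ) ^ n • ∑ i ∈ range n,
        insertAt X.invol (φ n) i (X.d.compMultilinearMap (idOp k A)) 1 x := by
    rcases n with _ | n
    · simp
    rw [sum_eq_single_of_mem 1 (by simp), smul_sum]
    · refine sum_congr rfl fun i _ => ?_
      congr 1
      refine neg_one_pow_eq_of_zmod ?_
      push_cast
      linear_combination ((i : ZMod 2) + 1) * zmod_two_eq_zero
    · intro l hl hl1
      refine sum_eq_zero fun i hi => ?_
      rw [mem_Icc] at hl
      obtain ⟨l, rfl⟩ : ∃ m, l = m + 2 := ⟨l - 2, by omega⟩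
      rw [unaryFamily, insertAt_zero X.invol _ (mem_range.1 hi), smul_zero]
      omega
  rw [hsum, smul_neg, smul_smul, smul_smul, smul_smul, ← pow_add, ← pow_add, ← pow_add]
  congr 2
  refine neg_one_pow_eq_of_zmod ?_
  push_cast
  linear_combination (-(n : ZMod 2)) * zmod_two_eq_zero
end Insertions

/-! ### Substitution of families of operations into one another -/

section Compositions

theorem blocks_eq_nil_of_zero (c : Composition 0) : c.blocks = [] := by
  rcases hc : c.blocks with _ | ⟨b, l⟩
  · rfl
  · have h1 := c.blocks_sum
    have h2 := c.blocks_pos (i := b) (by simp [hc])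
    rw [hc, List.sum_cons] at h1
    omega

theorem sum_composition_zero {M : Type*} [AddCommMonoid M] (f : List ℕ → M) :
    ∑ c : Composition 0, f c.blocks = f [] := by
  rw [sum_congr rfl fun c _ => by rw [blocks_eq_nil_of_zero c]]
  simp [composition_card]

/-- The recursion for sums over the compositions of a number: a composition of `n + 1` arises from
one of `n` by increasing the first block or by putting a block `1` in front. -/
theorem sum_composition_succ {M : Type*} [AddCommMonoid M] (f : List ℕ → M) (n : ℕ) :
    ∑ c : Composition (n + 1), f c.blocks = ∑ c : Composition n, (match c.blocks with
      | [] => f [1]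
      | b :: l => f ((b + 1) :: l) + f (1 :: b :: l)) := by
  rcases n with _ | n
  · refine Eq.trans ?_ (sum_composition_zero fun l => match l with
      | [] => f [1]
      | b :: l => f ((b + 1) :: l) + f (1 :: b :: l)).symm
    rw [sum_eq_single_of_mem (Composition.single 1 one_pos) (mem_univ _)]
    · simp [Composition.single_blocks]
    · intro c _ hc
      exact absurd ((Composition.eq_single_iff_length one_pos).2 (le_antisymm c.length_le
        (c.length_pos_of_pos one_pos))) hc
  let e : Composition (n + 1) ⊕ Composition (n + 1) → Composition (n + 2) := Sum.elim
    (fun c => ⟨match c.blocks with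
      | [] => [n + 2]
      | b :: l => (b + 1) :: l, by
        intro i
        rcases hc : c.blocks with _ | ⟨b, l⟩
        · simp; omega
        · have := fun j hj => c.blocks_pos (i := j) hj
          rw [hc] at this
          simp only [List.mem_cons] at this ⊢
          rintro (rfl | h)
          · omega
          · exact this i (Or.inr h), by
        have := c.blocks_sum
        rcases hc : c.blocks with _ | ⟨b, l⟩
        · simp
        · rw [hc] at this
          simp at this ⊢
          omega⟩)
    (fun c => ⟨1 :: c.blocks, by
      intro i hi
      rcases List.mem_cons.1 hi with rfl | h
      · exact one_pos
      · exact c.blocks_pos h, by simp [c.blocks_sum]; omega⟩)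
  have hne : ∀ c : Composition (n + 1), ∃ b l, c.blocks = (b + 1) :: l := by
    intro c
    have h1 := c.blocks_sum
    have h2 := fun j hj => c.blocks_pos (i := j) hj
    rcases hc : c.blocks with _ | ⟨b, l⟩
    · simp [hc] at h1
    · exact ⟨b - 1, l, by rw [Nat.sub_add_cancel (h2 b (by simp [hc]))]⟩
  have hel : ∀ c, ∃ b l, c.blocks = (b + 1) :: l ∧ (e (Sum.inl c)).blocks = (b + 2) :: l := by
    intro c
    obtain ⟨b, l, h⟩ := hne c
    exact ⟨b, l, h, by simp only [e, Sum.elim_inl, h]⟩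
  have her : ∀ c, (e (Sum.inr c)).blocks = 1 :: c.blocks := fun c => rfl
  have he : Function.Bijective e := by
    refine ⟨?_, fun c => ?_⟩
    · rintro (c | c) (c' | c') h <;> have h' := congrArg Composition.blocks h
      · obtain ⟨b, l, h1, h2⟩ := hel c
        obtain ⟨b', l', h1', h2'⟩ := hel c'
        rw [h2, h2'] at h'
        congr 1
        ext1
        rw [h1, h1']
        simpa using h'
      · obtain ⟨b, l, h1, h2⟩ := hel c
        rw [h2, her] at h'
        simp at h'
      · obtain ⟨b, l, h1, h2⟩ := hel c'
        rw [h2, her] at h'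
        simp at h'
      · rw [her, her] at h'
        congr 1
        ext1
        simpa using h'
    · have h1 := c.blocks_sum
      have h2 := fun j hj => c.blocks_pos (i := j) hj
      rcases hc : c.blocks with _ | ⟨b, l⟩
      · simp [hc] at h1
      rw [hc] at h1 h2
      have hl : ∀ {i}, i ∈ l → 0 < i := fun {i} hi => h2 i (List.mem_cons_of_mem _ hi)
      have hb := h2 b (by simp)
      rw [List.sum_cons] at h1
      rcases eq_or_ne b 1 with rfl | hb1
      · refine ⟨Sum.inr ⟨l, hl, by omega⟩, ?_⟩
        ext1
        rw [her, hc]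
      · refine ⟨Sum.inl ⟨(b - 1) :: l, ?_, ?_⟩, ?_⟩
        · intro i hi
          rcases List.mem_cons.1 hi with rfl | h
          · omega
          · exact hl h
        · rw [List.sum_cons]; omega
        · ext1
          simp only [e, Sum.elim_inl, hc]
          rw [Nat.sub_add_cancel hb]
  rw [← Fintype.sum_bijective e he (fun c => f (e c).blocks) _ fun _ => rfl, Fintype.sum_sum_type,
    ← sum_add_distrib]
  refine sum_congr rfl fun c _ => ?_
  obtain ⟨b, l, h1, h2⟩ := hel c
  simp only [h2, her, h1]

theorem sum_composition_eq_blockSum {α M : Type*} [AddCommMonoid M] (f : List (List α) → M)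
    (w : List α) {n : ℕ} (hn : w.length = n) :
    ∑ c : Composition n, f (List.splitWrtCompositionAux w c.blocks) = blockSum f w := by
  induction w generalizing f n with
  | nil =>
    subst hn
    exact sum_composition_zero fun l => f (List.splitWrtCompositionAux [] l)
  | cons x w ih =>
    subst hn
    rw [blockSum, ← ih _ rfl, List.length_cons,
      sum_composition_succ fun l => f (List.splitWrtCompositionAux (x :: w) l)]
    refine sum_congr rfl fun c _ => ?_
    rcases hc : c.blocks with _ | ⟨b, l⟩
    · have : w = [] := by
        have := c.blocks_sum
        rw [hc] at this
        exact List.length_eq_zero_iff.1 this.symm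
      subst this
      simp [List.splitWrtCompositionAux]
    · simp [List.splitWrtCompositionAux, List.splitAt_eq]
end Compositions

section Substitution
variable {k A B C : Type*} [Field k] [AddCommGroup A] [Module k A] [AddCommGroup B] [Module k B]
  [AddCommGroup C] [Module k C]

theorem sum_Ioi_get (g : ℕ → ℕ) (l : List ℕ) (i : Fin l.length) :
    ∑ j ∈ Ioi i, g (l.get j) = ((l.drop (i + 1)).map g).sum := by
  induction l with
  | nil => exact i.elim0
  | cons a l ih =>
    refine Fin.cases ?_ (fun i => ?_) i
    · exact (Fin.sum_Ioi_zero _).trans (by simp [← Fin.sum_univ_fun_getElem])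
    · exact (Fin.sum_Ioi_succ _ _).trans (by simpa using ih i)

/-- The exponent `∑_{i < j} r_i (r_j + 1)` of a list `r_1, …, r_m`. -/
def thetaList : List ℕ → ℕ
  | [] => 0
  | r :: l => r * (l.map (· + 1)).sum + thetaList l

theorem theta_eq_thetaList {n : ℕ} (c : Composition n) : theta c = thetaList c.blocks := by
  have key : ∀ l : List ℕ, ∑ i : Fin l.length, ∑ j ∈ Ioi i, l.get i * (l.get j + 1) =
      thetaList l := by
    intro l
    induction l with
    | nil => rfl
    | cons a l ih =>
      refine (Fin.sum_univ_succ _).trans ?_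
      rw [thetaList, ← ih]
      congr 1
      · rw [← mul_sum]
        congr 1
        exact sum_Ioi_get (· + 1) (a :: l) 0
      · exact sum_congr rfl fun i _ => Fin.sum_Ioi_succ _ _
  exact key c.blocks

/-- The letters to which the outer operation is applied in `φ ∘ (ψ_{r_1} ⊗ ⋯ ⊗ ψ_{r_m})`, the
Koszul signs for the `ψ_r` of degree `1 - r` included. -/
def blockLetters (γ : A →ₗ[k] A) (ψ : ∀ n, Op k A B n) : List (List A) → List B
  | [] => []
  | b :: p => ev ψ (b.map (γ ^ (p.map fun b' => b'.length + 1).sum : A →ₗ[k] A)) :: blockLetters γ ψ p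

theorem length_blockLetters (γ : A →ₗ[k] A) (ψ : ∀ n, Op k A B n) (p : List (List A)) :
    (blockLetters γ ψ p).length = p.length := by
  induction p with
  | nil => rfl
  | cons b p ih => simp [blockLetters, ih]

theorem getElem_blockLetters (γ : A →ₗ[k] A) (ψ : ∀ n, Op k A B n) (p : List (List A)) (i : ℕ)
    (hi : i < (blockLetters γ ψ p).length) : (blockLetters γ ψ p)[i] =
      ev ψ ((p[i]'(by rwa [length_blockLetters] at hi)).map
        (γ ^ ((p.drop (i + 1)).map fun b' => b'.length + 1).sum : A →ₗ[k] A)) := by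
  induction p generalizing i with
  | nil => simp [blockLetters] at hi
  | cons b p ih =>
    cases i with
    | zero => simp [blockLetters]
    | succ i =>
      simp only [blockLetters, List.getElem_cons_succ, List.drop_succ_cons]
      exact ih i _

theorem blockComp_eq_ev (γ : A →ₗ[k] A) {n : ℕ} (c : Composition n) (φ : ∀ n, Op k B C n)
    (ψ : ∀ n, Op k A B n) {x : Fin n → A} {w : List A} (hx : List.ofFn x = w) :
    blockComp γ c (φ c.length) (fun i => ψ (c.blocksFun i)) (fun i => c.blocksFun i + 1) x =
      ev φ (blockLetters γ ψ (w.splitWrtCompositionAux c.blocks)) := by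
  have hw : w.length = n := by simp [← hx]
  have hlen : (w.splitWrtCompositionAux c.blocks).map List.length = c.blocks :=
    List.map_length_splitWrtCompositionAux (by rw [c.blocks_sum, hw])
  have hpl : (w.splitWrtCompositionAux c.blocks).length = c.length :=
    List.length_splitWrtCompositionAux _ _
  rw [blockComp_apply]
  refine ev_eq φ (by rw [length_blockLetters, hpl]) fun i hi => ?_
  rw [getElem_blockLetters]
  have hi' : ((w.splitWrtCompositionAux c.blocks)[i]'(by omega)).length = c.blocksFun ⟨i, hi⟩ := by
    have : ((w.splitWrtCompositionAux c.blocks).map List.length)[i]'(by simp; omega) =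
      c.blocks[i]'hi := by simp only [hlen]
    rw [List.getElem_map] at this
    exact this
  have hexp : ∑ j ∈ Ioi (⟨i, hi⟩ : Fin c.length), (c.blocksFun j + 1) =
      (((w.splitWrtCompositionAux c.blocks).drop (i + 1)).map fun b' => b'.length + 1).sum := by
    refine (sum_Ioi_get (· + 1) c.blocks ⟨i, hi⟩).trans ?_
    have h := congrArg (fun l : List ℕ => ((l.drop (i + 1)).map (· + 1)).sum) hlen.symm
    refine h.trans ?_
    simp only [← List.map_drop, List.map_map]
    rfl
  refine ev_eq ψ (by simpa using hi') fun j hj => ?_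
  rw [List.getElem_map, hexp]
  congr 1
  have := List.getElem_splitWrtComposition' w c (i := i) (by
    rw [List.length_splitWrtComposition]; exact hi)
  simp only [List.splitWrtComposition] at this
  simp only [this, List.getElem_drop, List.getElem_take]
  simp [← hx, Composition.embedding]

/-- The factorization of `twist γ w` corresponding to the factorization `p` of `w`. -/
def twistBlocks (γ : A →ₗ[k] A) : List (List A) → List (List A)
  | [] => []
  | b :: p => (twist γ b).map (γ ^ p.flatten.length) :: twistBlocks γ p

theorem blockSum_twist {M : Type*} [AddCommMonoid M] (γ : A →ₗ[k] A) (f : List (List A) → M)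
    (w : List A) : blockSum f (twist γ w) = blockSum (fun p => f (twistBlocks γ p)) w := by
  induction w generalizing f with
  | nil => rfl
  | cons x w ih =>
    simp only [twist, blockSum]
    rw [ih]
    refine blockSum_congr fun p hp _ => ?_
    cases p with
    | nil => subst hp; simp [twistBlocks, twist]
    | cons b p =>
      subst hp
      simp only [twistBlocks, twist, List.flatten_cons, List.map_cons, List.map_nil,
        List.length_append, List.length_nil, pow_zero, Module.End.one_apply]
      congr 4
      rw [add_comm, pow_add]; rfl

/-- The exponent of the signs which arise from moving the grading involutions of a factorization
through the operations `ψ_r` of degree `1 - r`, and from the normalisation of `bar`. -/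
def blockExponent : List (List A) → ℕ
  | [] => 0
  | b :: p => (b.length + 1) * p.length + b.length.choose 2 + blockExponent p

theorem ev_blockLetters {γ : A →ₗ[k] A} (hγ : ∀ x, γ (γ x) = x) {γ' : B →ₗ[k] B}
    (φ : ∀ n, Op k B C n) {ψ : ∀ n, Op k A B n} (hψ : HasParity γ γ' ψ fun n => n + 1)
    (q : List B) (p : List (List A)) :
    ev φ (q ++ blockLetters γ ψ (twistBlocks γ p)) =
      (-1 : ℤ) ^ blockExponent p • ev φ (q ++ twist γ' (p.map (bar γ ψ))) := by
  have hlen : ∀ p : List (List A), (twistBlocks γ p).map (fun b' => b'.length + 1) =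
      p.map fun b' => b'.length + 1 := by
    intro p
    induction p with
    | nil => rfl
    | cons b p ih => simp [twistBlocks, ih]
  have hsum : ∀ p : List (List A), (p.map fun b' => b'.length + 1).sum =
      p.flatten.length + p.length := by
    intro p
    induction p with
    | nil => rfl
    | cons b p ih => simp [ih] at *; omega
  induction p generalizing q with
  | nil => simp [blockLetters, twistBlocks, blockExponent, twist]
  | cons b p ih =>
    have h := ih (q ++ [ev ψ ((twist γ b).map (γ ^ p.length))])
    simp only [List.append_assoc, List.cons_append, List.nil_append] at h
    simp only [blockLetters, twistBlocks, hlen, hsum, map_pow_map_pow, List.map_cons, twist]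
    rw [pow_eq_of_zmod hγ (b := p.length), h, hψ.ev_map_pow, ev_twist, length_twist,
      ← evLinear_apply, ← evLinear_apply, map_zsmul, map_zsmul, map_zsmul, smul_smul, smul_smul,
      ← pow_add, ← pow_add, List.length_map, blockExponent]
    · congr 2
      ring
    · push_cast; linear_combination (p.flatten.length : ZMod 2) * zmod_two_eq_zero

/-- The sums over compositions which occur in the definition of `A_∞`-morphisms and their
composites are substitutions without signs in the bar construction. -/
theorem sum_blockComp_eq_subst {γ : A →ₗ[k] A} (hγ : ∀ x, γ (γ x) = x) {γ' : B →ₗ[k] B}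
    (φ : ∀ n, Op k B C n) {ψ : ∀ n, Op k A B n} (hψ : HasParity γ γ' ψ fun n => n + 1) {n : ℕ}
    {x : Fin n → A} {w : List A} (hx : List.ofFn x = twist γ w) :
    (-1 : ℤ) ^ n.choose 2 • ∑ c : Composition n, (-1 : ℤ) ^ theta c •
        blockComp γ c (φ c.length) (fun i => ψ (c.blocksFun i)) (fun i => c.blocksFun i + 1) x =
      subst (bar γ ψ) (bar γ' φ) w := by
  have hn : w.length = n := by simpa using (congrArg List.length hx).symm
  have hlen : ∀ p : List (List A), (twistBlocks γ p).map List.length = p.map List.length := by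
    intro p
    induction p with
    | nil => rfl
    | cons b p ih => simp [twistBlocks, ih]
  have h := sum_composition_eq_blockSum (fun p => (-1 : ℤ) ^ n.choose 2 •
    (-1 : ℤ) ^ thetaList (p.map List.length) • ev φ (blockLetters γ ψ p)) (twist γ w) (n := n)
    (by simpa using hn)
  rw [blockSum_twist] at h
  rw [smul_sum, subst]
  refine Eq.trans (sum_congr rfl fun c _ => ?_) (h.trans (blockSum_congr fun p hp hp' => ?_))
  · rw [blockComp_eq_ev γ c φ ψ hx, theta_eq_thetaList, List.map_length_splitWrtCompositionAux]
    rw [c.blocks_sum, length_twist, hn]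
  · have h2 := ev_blockLetters hγ φ hψ [] p
    simp only [List.nil_append] at h2
    rw [h2, bar, smul_smul, smul_smul, hlen, ← pow_add, ← pow_add, List.length_map, ← hn, ← hp]
    congr 1
    refine neg_one_pow_eq_of_zmod ?_
    clear h h2 hn hp hx hp'
    induction p with
    | nil => rfl
    | cons b p ih =>
      have hs : ((p.map List.length).map (· + 1)).sum = p.flatten.length + p.length := by
        clear ih
        induction p with
        | nil => rfl
        | cons b p ih =>
          simp only [List.map_cons, List.sum_cons, List.flatten_cons, List.length_append,
            List.length_cons, ih]
          omega
      simp only [List.flatten_cons, List.length_append, List.map_cons, thetaList, blockExponent,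
        List.length_cons, add_choose_two, hs]
      simp only [Nat.choose_succ_self]
      push_cast at ih ⊢
      linear_combination ih + ((b.length.choose 2 : ZMod 2) + b.length * p.flatten.length +
        b.length * p.length) * zmod_two_eq_zero

end Substitution

/-! ### Degrees, filtrations and parities of the kernels -/

theorem pow_apply_mem {k A : Type*} [Field k] [AddCommGroup A] [Module k A] {V : Submodule k A}
    {γ : A →ₗ[k] A} (hγ : ∀ y ∈ V, γ y ∈ V) (j : ℕ) {y : A} (hy : y ∈ V) : (γ ^ j) y ∈ V := by
  induction j with
  | zero => exact hy
  | succ j ih => rw [pow_succ']; exact hγ _ ih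

section Degree
variable {k A B C ι : Type*} [Field k] [AddCommGroup A] [Module k A] [AddCommGroup B] [Module k B]
  [AddCommGroup C] [Module k C] [AddCommGroup ι]

/-- The operation `φ` raises the index of families of subspaces by `e`. For `ι = ℤ` and the graded
pieces this says that `φ` has degree `e`; for `ι = ℤ × ℤ` and the pieces `F^p A^n` it says that `φ`
is filtered of some degree. -/
def HasDegree (S : ι → Submodule k A) (S' : ι → Submodule k B) {n : ℕ} (φ : Op k A B n) (e : ι) :
    Prop :=
  ∀ (a : Fin n → ι) (x : Fin n → A), (∀ i, x i ∈ S (a i)) → φ x ∈ S' (∑ i, a i + e)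

variable {S : ι → Submodule k A} {S' : ι → Submodule k B} {S'' : ι → Submodule k C}

namespace HasDegree

theorem zero {n : ℕ} (e : ι) : HasDegree S S' (0 : Op k A B n) e :=
  fun _ _ _ => Submodule.zero_mem _

theorem add {n : ℕ} {φ ψ : Op k A B n} {e : ι} (hφ : HasDegree S S' φ e)
    (hψ : HasDegree S S' ψ e) : HasDegree S S' (φ + ψ) e :=
  fun a x hx => Submodule.add_mem _ (hφ a x hx) (hψ a x hx)

theorem neg {n : ℕ} {φ : Op k A B n} {e : ι} (hφ : HasDegree S S' φ e) :
    HasDegree S S' (-φ) e :=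
  fun a x hx => Submodule.neg_mem _ (hφ a x hx)

theorem zsmul {n : ℕ} {φ : Op k A B n} {e : ι} (hφ : HasDegree S S' φ e) (m : ℤ) :
    HasDegree S S' (m • φ) e :=
  fun a x hx => zsmul_mem (hφ a x hx) m

theorem sum {n : ℕ} {J : Type*} {s : Finset J} {φ : J → Op k A B n} {e : ι}
    (hφ : ∀ j ∈ s, HasDegree S S' (φ j) e) : HasDegree S S' (∑ j ∈ s, φ j) e := by
  intro a x hx
  rw [_root_.sum_apply]
  exact Submodule.sum_mem _ fun j hj => hφ j hj a x hx

theorem comp {n : ℕ} {φ : Op k A B n} {e t : ι} (hφ : HasDegree S S' φ e) {L : B →ₗ[k] C}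
    (hL : ∀ a, ∀ y ∈ S' a, L y ∈ S'' (a + t)) : HasDegree S S'' (L.compMultilinearMap φ) (e + t) :=
  fun a x hx => by simpa [add_assoc] using hL _ _ (hφ a x hx)

theorem compLinearMap {n : ℕ} {φ : Op k B C n} {e : ι} (hφ : HasDegree S' S'' φ e)
    {L : A →ₗ[k] B} (hL : ∀ a, ∀ y ∈ S a, L y ∈ S' a) :
    HasDegree S S'' (φ.compLinearMap fun _ => L) e :=
  fun a _ hx => hφ a _ fun i => hL _ _ (hx i)

theorem idOp : HasDegree S S (idOp k A) 0 := fun _ _ hx => by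
  simpa [FilteredTransfer.idOp] using hx 0

theorem mulTensor {γ : A →ₗ[k] A} (hγ : ∀ a, ∀ y ∈ S a, γ y ∈ S a) {μ : A →ₗ[k] A →ₗ[k] A}
    (hμ : ∀ a b, ∀ y ∈ S a, ∀ z ∈ S b, μ y z ∈ S (a + b)) {a b n : ℕ} (hn : a + b = n)
    {φ : Op k A A a} {ψ : Op k A A b} {s t : ι} (hφ : HasDegree S S φ s)
    (hψ : HasDegree S S ψ t) (e : ℕ) :
    HasDegree S S (mulTensor γ μ hn φ ψ e) (s + t) := by
  intro i x hx
  subst hn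
  rw [mulTensor_apply, Fin.sum_univ_add]
  have := hμ _ _ _ (hφ (fun j => i (Fin.castAdd b j)) _ fun j => pow_apply_mem (hγ _) e (hx _)) _
    (hψ (fun j => i (Fin.natAdd a j)) (fun j => x (Fin.natAdd a j)) fun j => hx _)
  rw [add_add_add_comm]
  exact this

theorem blockComp {γ : A →ₗ[k] A} (hγ : ∀ a, ∀ y ∈ S a, γ y ∈ S a) {n : ℕ} (c : Composition n)
    {φ : Op k B C c.length} {ψ : ∀ i, Op k A B (c.blocksFun i)} {s : ι} {t : Fin c.length → ι}
    (hφ : HasDegree S' S'' φ s) (hψ : ∀ i, HasDegree S S' (ψ i) (t i)) (e : Fin c.length → ℕ) :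
    HasDegree S S'' (blockComp γ c φ ψ e) (∑ i, t i + s) := by
  intro a x hx
  rw [blockComp_apply]
  have := hφ _ _ fun i => hψ i (fun b => a (c.embedding i b)) _
    fun b => pow_apply_mem (hγ _) (∑ j ∈ Ioi i, e j) (hx (c.embedding i b))
  rw [sum_add_distrib] at this
  have hsum : ∑ i, ∑ b, a (c.embedding i b) = ∑ j, a j := by
    rw [← Fintype.sum_sigma']
    exact Fintype.sum_equiv c.blocksFinEquiv _ _ fun _ => rfl
  rwa [hsum, add_assoc] at this

end HasDegree

theorem hasDegree_blockComp_family {u : ι} {γ : A →ₗ[k] A} (hγ : ∀ a, ∀ y ∈ S a, γ y ∈ S a) {n : ℕ}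
    (c : Composition n) {φ : Op k B C c.length} {ψ : ∀ n, Op k A B n}
    (hφ : HasDegree S' S'' φ ((1 - c.length : ℤ) • u))
    (hψ : ∀ r ≤ n, HasDegree S S' (ψ r) ((1 - r : ℤ) • u)) (e : Fin c.length → ℕ) :
    HasDegree S S'' (blockComp γ c φ (fun i => ψ (c.blocksFun i)) e) ((1 - n : ℤ) • u) := by
  have h := HasDegree.blockComp hγ c hφ (fun i => hψ _ (c.blocksFun_le i)) e
  convert h using 1
  rw [← sum_smul, ← add_smul]
  congr 1
  rw [sum_sub_distrib, ← Nat.cast_sum, c.sum_blocksFun]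
  simp

theorem hasDegree_idAInf (u : ι) (n : ℕ) : HasDegree S S (idAInf k A n) ((1 - n : ℤ) • u) := by
  match n with
  | 0 => exact .zero _
  | 1 =>
    show HasDegree S S (FilteredTransfer.idOp k A) _
    simpa using HasDegree.idOp (k := k) (S := S)
  | n + 2 => exact .zero _

theorem negOnePow_sum {J : Type*} (s : Finset J) (a : J → ℤ) :
    (∑ j ∈ s, a j).negOnePow = ∏ j ∈ s, (a j).negOnePow := by
  classical
  induction s using Finset.induction_on with
  | empty => simp
  | insert j s hj ih => rw [sum_insert hj, prod_insert hj, Int.negOnePow_add, ih]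

/-- An operation of degree `e` commutes with the grading involutions up to `(-1)^e`. -/
theorem HasDegree.invol {X : FilteredComplex k A} {Y : FilteredComplex k B} {n : ℕ}
    {φ : Op k A B n} {e : ℤ} (hφ : HasDegree X.gr Y.gr φ e) (x : Fin n → A) :
    Y.invol (φ x) = (e.negOnePow : ℤ) • φ fun i => X.invol (x i) := by
  classical
  have key : Y.invol.compMultilinearMap φ =
      (e.negOnePow : ℤ) • φ.compLinearMap fun _ => X.invol := by
    refine Module.Basis.ext_multilinear
      (fun _ => X.isInternal.collectedBasis fun n => Module.Basis.ofVectorSpace k (X.gr n))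
      fun v => ?_
    set y : Fin n → A := fun i =>
      X.isInternal.collectedBasis (fun n => Module.Basis.ofVectorSpace k (X.gr n)) (v i) with hy
    have hmem : ∀ i, y i ∈ X.gr (v i).1 := fun i => X.isInternal.collectedBasis_mem _ _
    have hinv : (fun i => X.invol (y i)) =
        fun i => ((((v i).1.negOnePow : ℤˣ) : ℤ) : k) • y i := by
      ext i
      rw [X.invol_of_mem (hmem i), Int.cast_smul_eq_zsmul]
    simp only [LinearMap.compMultilinearMap_apply, _root_.smul_apply,
      MultilinearMap.compLinearMap_apply]
    rw [hinv, MultilinearMap.map_smul_univ, Y.invol_of_mem (hφ _ y hmem), Int.negOnePow_add,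
      negOnePow_sum, ← Int.cast_prod, Int.cast_smul_eq_zsmul, smul_smul, mul_comm,
      Units.val_mul, Units.coe_prod]
  exact congrFun (congrArg DFunLike.coe key) x

end Degree

section Kernels
variable {k A B ι : Type*} [Field k] [AddCommGroup A] [Module k A] [AddCommGroup B] [Module k B]
  [AddCommGroup ι]

/-- Families of subspaces of `A` and `B` which are respected by all maps of a transfer diagram, `h`
lowering the index by `u`. -/
structure IsCompatible (X : FilteredDGAlgebra k A) {Y : FilteredComplex k B}
    (T : TransferDiagram X.toFilteredComplex Y) (S : ι → Submodule k A) (S' : ι → Submodule k B)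
    (u : ι) : Prop where
  invol : ∀ a, ∀ x ∈ S a, X.invol x ∈ S a
  mul : ∀ a b, ∀ x ∈ S a, ∀ y ∈ S b, X.mul x y ∈ S (a + b)
  f : ∀ a, ∀ x ∈ S a, T.f x ∈ S' a
  g : ∀ a, ∀ x ∈ S' a, T.g x ∈ S a
  h : ∀ a, ∀ x ∈ S a, T.h x ∈ S (a + -u)

variable {X : FilteredDGAlgebra k A} {Y : FilteredComplex k B}
  {T : TransferDiagram X.toFilteredComplex Y}

theorem isCompatible_gr : IsCompatible X T X.gr Y.gr 1 where
  invol a x hx := by rw [X.invol_of_mem hx]; exact zsmul_mem hx _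
  mul := X.mul_mem
  f := T.f_mem
  g := T.g_mem
  h := T.h_mem

theorem isCompatible_fil : IsCompatible X T (fun q : ℤ × ℤ => X.fil q.1 q.2)
    (fun q => Y.fil q.1 q.2) (0, 1) where
  invol a x hx := by rw [X.invol_of_mem (X.fil_le _ _ hx)]; exact zsmul_mem hx _
  mul a b x hx y hy := X.mul_fil _ _ _ _ x hx y hy
  f a := T.f_fil _ _
  g a := T.g_fil _ _
  h a x hx := by
    have := T.h_fil _ _ x hx
    rw [sub_eq_add_neg] at this
    simpa using this

namespace IsCompatible
variable {S : ι → Submodule k A} {S' : ι → Submodule k B} {u : ι} (hT : IsCompatible X T S S' u)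
include hT

theorem applyH {n : ℕ} {φ : Op k A A n} (hφ : HasDegree S S φ ((2 - n : ℤ) • u)) :
    HasDegree S S (applyH T.h n φ) ((1 - n : ℤ) • u) := by
  rcases eq_or_ne n 1 with rfl | hn
  · show HasDegree S S (FilteredTransfer.idOp k A) _
    simpa using HasDegree.idOp (k := k) (S := S)
  · have h := hφ.comp hT.h
    have e : (2 - n : ℤ) • u + -u = (1 - n : ℤ) • u := by module
    rw [e] at h
    match n, hn, φ, h with
    | 0, _, _, h => exact h
    | n + 2, _, _, h => exact h

theorem pKernel (n : ℕ) :
    HasDegree S S (pKernel X.invol X.mul T.h n) ((2 - n : ℤ) • u) := by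
  induction n using Nat.strong_induction_on with
  | _ n ih =>
    match n with
    | 0 => rw [FilteredTransfer.pKernel]; exact .zero _
    | 1 => rw [FilteredTransfer.pKernel]; exact .zero _
    | m + 2 =>
      rw [FilteredTransfer.pKernel]
      refine .sum fun j _ => .zsmul ?_ _
      have hj := j.2
      have h := HasDegree.mulTensor hT.invol hT.mul
        (by omega : ((j : ℕ) + 1) + (m + 1 - (j : ℕ)) = m + 2)
        (hT.applyH (ih (j + 1) (by omega))) (hT.applyH (ih (m + 1 - (j : ℕ)) (by omega)))
        ((m + 1 - (j : ℕ)) + 1)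
      convert h using 1
      rw [← add_smul]
      congr 1
      push_cast [Nat.cast_sub (show (j : ℕ) ≤ m + 1 by omega)]
      ring

theorem hpKernel (n : ℕ) :
    HasDegree S S (hpKernel X.invol X.mul T.h n) ((1 - n : ℤ) • u) :=
  hT.applyH (hT.pKernel n)

theorem qKernel (n : ℕ) :
    HasDegree S S (qKernel X.invol X.mul T.h (T.g ∘ₗ T.f) n) ((1 - n : ℤ) • u) := by
  induction n using Nat.strong_induction_on with
  | _ n ih =>
    have hu : ∀ a, ∀ x ∈ S a, (T.g ∘ₗ T.f) x ∈ S (a + 0) := fun a x hx => by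
      rw [add_zero]; exact hT.g _ _ (hT.f _ _ hx)
    match n with
    | 0 => rw [FilteredTransfer.qKernel]; exact .zero _
    | 1 => rw [FilteredTransfer.qKernel]; simpa using HasDegree.idOp (k := k) (S := S)
    | m + 2 =>
      rw [qKernel_add_two]
      refine .add (.neg ?_) (.sum fun j _ => .zsmul ?_ _)
      · have h := HasDegree.mulTensor hT.invol hT.mul rfl ((ih (m + 1) (by omega)).comp hT.h)
          HasDegree.idOp 0
        convert h using 1
        push_cast
        module
      · have hj := j.2
        have hgf : HasDegree S S (gfKernel X.invol X.mul T.h (T.g ∘ₗ T.f)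
            (FilteredTransfer.qKernel X.invol X.mul T.h (T.g ∘ₗ T.f)) (j + 1))
            ((1 - (j + 1 : ℕ) : ℤ) • u) := by
          refine .add ?_ (.sum fun c _ => .zsmul ?_ _)
          · simpa using (ih (j + 1) (by omega)).comp hu
          · refine hasDegree_blockComp_family hT.invol c (hT.hpKernel _) (ψ := fun r =>
              (T.g ∘ₗ T.f).compMultilinearMap
                (FilteredTransfer.qKernel X.invol X.mul T.h (T.g ∘ₗ T.f) r)) (fun r hr => ?_) _
            simpa using (ih r (by omega)).comp hu
        have h := HasDegree.mulTensor hT.invol hT.mul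
          (by omega : ((j : ℕ) + 1) + (m + 1 - (j : ℕ)) = m + 2)
          hgf ((ih (m + 1 - (j : ℕ)) (by omega)).comp hT.h) (m + 1 - (j : ℕ))
        convert h using 1
        push_cast [Nat.cast_sub (show (j : ℕ) ≤ m + 1 by omega)]
        module

theorem transferProducts (n : ℕ) :
    HasDegree S' S' (transferProducts X T n) ((2 - n : ℤ) • u) := by
  rw [← add_zero ((2 - n : ℤ) • u)]
  exact ((hT.pKernel n).compLinearMap hT.g).comp (t := 0) (by simpa using hT.f)

theorem transferF (n : ℕ) : HasDegree S S' (transferF X T n) ((1 - n : ℤ) • u) := by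
  rw [← add_zero ((1 - n : ℤ) • u)]
  exact (hT.qKernel n).comp (t := 0) (by simpa using hT.f)

theorem transferG (n : ℕ) : HasDegree S' S (transferG X T n) ((1 - n : ℤ) • u) :=
  (hT.hpKernel n).compLinearMap hT.g

theorem transferH (n : ℕ) : HasDegree S S (transferH X T n) ((-n : ℤ) • u) := by
  have h := (hT.qKernel n).comp hT.h
  rwa [← sub_eq_add_neg, sub_smul, one_smul, sub_sub_cancel_left, ← neg_smul] at h

theorem compAInf (n : ℕ) :
    HasDegree S S (compAInf X.toFilteredComplex (FilteredTransfer.transferG X T)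
      (FilteredTransfer.transferF X T) n) ((1 - n : ℤ) • u) :=
  .sum fun c _ => .zsmul (hasDegree_blockComp_family hT.invol c (hT.transferG _)
    (fun r _ => hT.transferF r) _) _

end IsCompatible

end Kernels

/-! ### The relations in terms of the bar construction -/

theorem exists_ofFn_eq {α : Type*} (w : List α) {n : ℕ} (hn : w.length = n) :
    ∃ x : Fin n → α, List.ofFn x = w := by
  subst hn
  exact ⟨w.get, List.ofFn_get w⟩

section Relations
variable {k A B C : Type*} [Field k] [AddCommGroup A] [Module k A] [AddCommGroup B] [Module k B]
  [AddCommGroup C] [Module k C]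

theorem bar_eq (γ : A →ₗ[k] A) (φ : ∀ n, Op k A B n) {n : ℕ} {x : Fin n → A} {w : List A}
    (hx : List.ofFn x = twist γ w) : bar γ φ w = (-1 : ℤ) ^ n.choose 2 • φ n x := by
  have hn : w.length = n := by simpa using (congrArg List.length hx).symm
  rw [bar, ← hx, ev_ofFn, hn]

theorem neg_one_pow_smul_cancel {M : Type*} [AddCommGroup M] (n : ℕ) {y z : M}
    (h : (-1 : ℤ) ^ n • y = (-1 : ℤ) ^ n • z) : y = z := by
  rcases neg_one_pow_eq_or ℤ n with h1 | h1 <;> simpa [h1] using h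

theorem blockComp_zero (γ : A →ₗ[k] A) {n : ℕ} (c : Composition n)
    (ψ : ∀ i, Op k A B (c.blocksFun i)) (e : Fin c.length → ℕ) (x : Fin n → A) :
    blockComp γ c (0 : Op k B C c.length) ψ e x = 0 := rfl

theorem eq_zero_of_lt_two {ν : ∀ n, Op k B C n} (h0 : ν 0 = 0) (h1 : ν 1 = 0) {n : ℕ}
    (hn : n < 2) : ν n = 0 := by
  interval_cases n
  · exact h0
  · exact h1

/-- The relations of an `A_∞`-algebra say that the coderivation with components `d - ν` squares to
zero. -/
theorem aInfAlgebra_relation {X : FilteredComplex k A} {ν : ∀ n, Op k A A n}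
    (hν : HasParity X.invol X.invol ν fun n => n) (h0 : ν 0 = 0) (h1 : ν 1 = 0)
    (h : post X.d (bar X.invol ν) +
      coder (k := k) (-X.invol) (post X.d proj - bar X.invol ν) (bar X.invol ν) = 0)
    {n : ℕ} (hn : 2 ≤ n) (x : Fin n → A) :
    delta X X (ν n) n x +
      ∑ l ∈ Ico 2 n, ∑ i ∈ range (n + 1 - l),
        (-1 : ℤ) ^ ((i + 1) * (l + 1) + n) •
          insertAt X.invol (ν (n + 1 - l)) i (ν l) l x = 0 := by
  obtain ⟨w, hw⟩ : ∃ w, List.ofFn x = twist X.invol w :=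
    ⟨twist X.invol (List.ofFn x), (twist_twist X.invol_invol _).symm⟩
  have e1 := delta_eq_bar X X ν n hw
  have e2 := sum_insertAt_eq_bar X.invol_invol ν hν h0 h1 hw
  have e3 := congrFun h w
  rw [Pi.add_apply, coder_bar_sub] at e3
  have e4 : ∑ i ∈ range (n + 1 - n), (-1 : ℤ) ^ ((i + 1) * (n + 1) + n) •
      insertAt X.invol (ν (n + 1 - n)) i (ν n) n x = 0 := by
    refine sum_eq_zero fun i _ => ?_
    rw [eq_zero_of_lt_two h0 h1 (show n + 1 - n < 2 by omega), insertAt,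
      _root_.zero_apply, smul_zero]
  rw [← Finset.Ico_insert_right hn, sum_insert (by simp), e4, zero_add] at e2
  refine neg_one_pow_smul_cancel (n.choose 2) ?_
  rw [smul_add, e1, e2, smul_zero, neg_one_pow_eq_of_zmod (b := 0), pow_zero, one_smul,
    add_assoc, ← sub_eq_add_neg]
  · exact e3
  · push_cast; linear_combination (n : ZMod 2) * zmod_two_eq_zero

/-- The relations of an `A_∞`-morphism say that the induced coalgebra map is compatible with the
codifferentials. -/
theorem aInfMorphism_relation {X : FilteredComplex k A} {Y : FilteredComplex k B}
    {μ : ∀ n, Op k A A n} {ν : ∀ n, Op k B B n} {F : ∀ n, Op k A B n}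
    (hμ : HasParity X.invol X.invol μ fun n => n) (h0 : μ 0 = 0) (h1 : μ 1 = 0)
    (hν0 : ν 0 = 0) (hν1 : ν 1 = 0) (hF : HasParity X.invol Y.invol F fun n => n + 1)
    (h : post Y.d (bar X.invol F) -
      coder (k := k) (-X.invol) (post X.d proj - bar X.invol μ) (bar X.invol F) =
        subst (bar X.invol F) (bar Y.invol ν))
    {n : ℕ} (x : Fin n → A) :
    delta X Y (F n) (n + 1) x =
      ∑ c : Composition n with 2 ≤ c.length, (-1 : ℤ) ^ theta c •
        blockComp X.invol c (ν c.length) (fun i => F (c.blocksFun i))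
          (fun i => c.blocksFun i + 1) x +
      ∑ l ∈ Icc 2 n, ∑ i ∈ range (n + 1 - l),
        (-1 : ℤ) ^ ((i + 1) * (l + 1) + n) • insertAt X.invol (F (n + 1 - l)) i (μ l) l x := by
  obtain ⟨w, hw⟩ : ∃ w, List.ofFn x = twist X.invol w :=
    ⟨twist X.invol (List.ofFn x), (twist_twist X.invol_invol _).symm⟩
  have e1 := delta_eq_bar X Y F (n + 1) hw
  have e2 := sum_insertAt_eq_bar X.invol_invol F hμ h0 h1 hw
  have e3 := congrFun h w
  have e4 := sum_blockComp_eq_subst X.invol_invol ν hF hw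
  rw [Pi.sub_apply, coder_bar_sub] at e3
  rw [← sum_filter_add_sum_filter_not univ (fun c : Composition n => 2 ≤ c.length),
    sum_eq_zero (s := univ.filter fun c : Composition n => ¬ 2 ≤ c.length), add_zero] at e4
  · refine neg_one_pow_smul_cancel (n.choose 2) ?_
    rw [smul_add, e1, e2, e4, ← e3, neg_one_pow_eq_of_zmod (b := 1), pow_one]
    · simp only [post, LinearMap.compLeft_apply, Function.comp_apply]
      rw [neg_one_smul]
      abel
    · push_cast; linear_combination (n : ZMod 2) * zmod_two_eq_zero
  · intro c hc
    rw [mem_filter, not_le] at hc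
    rw [eq_zero_of_lt_two hν0 hν1 hc.2, blockComp_zero, smul_zero]

end Relations

/-! ### Dg-algebras -/

section DGAlgebra
variable {k A B : Type*} [Field k] [AddCommGroup A] [Module k A] [AddCommGroup B] [Module k B]

namespace FilteredDGAlgebra
variable (X : FilteredDGAlgebra k A)

theorem invol_mul (x y : A) : X.invol (X.mul x y) = X.mul (X.invol x) (X.invol y) := by
  have h : ∀ m, ∀ x ∈ X.gr m, X.invol ∘ₗ X.mul x = X.mul (X.invol x) ∘ₗ X.invol :=
    fun m x hx => X.ext_of_homogeneous fun n y hy => by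
      simp only [LinearMap.comp_apply]
      rw [X.invol_of_mem (X.mul_mem _ _ _ hx _ hy), X.invol_of_mem hx, X.invol_of_mem hy,
        Int.negOnePow_add, Units.val_mul, map_zsmul, map_zsmul, LinearMap.smul_apply, smul_smul,
        mul_comm]
  have h' : X.invol ∘ₗ X.mul.flip y = X.mul.flip (X.invol y) ∘ₗ X.invol :=
    X.ext_of_homogeneous fun m x hx => LinearMap.congr_fun (h m x hx) y
  exact LinearMap.congr_fun h' x

theorem d_mul (x y : A) :
    X.d (X.mul x y) = X.mul (X.d x) y + X.mul (X.invol x) (X.d y) := by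
  have h : X.d ∘ₗ X.mul.flip y = X.mul.flip y ∘ₗ X.d + X.mul.flip (X.d y) ∘ₗ X.invol :=
    X.ext_of_homogeneous fun m x hx => by
      simp only [LinearMap.comp_apply, LinearMap.add_apply, LinearMap.flip_apply]
      rw [X.leibniz m x hx, X.invol_of_mem hx, map_zsmul, LinearMap.smul_apply]
  exact LinearMap.congr_fun h x

/-- The product of a dg-algebra in the bar construction. -/
noncomputable def barMul : A →ₗ[k] A →ₗ[k] A := X.mul ∘ₗ X.invol

theorem barMul_apply (x y : A) : X.barMul x y = X.mul (X.invol x) y := rfl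

theorem barAlgebra : BarAlgebra X.d (-X.invol) X.barMul where
  invol x := by simp [X.invol_invol]
  d_invol x := by simp [X.invol_d]
  invol_mul x y := by simp [barMul_apply, X.invol_mul, X.invol_invol]
  leibniz x y := by simp [barMul_apply, X.d_mul, X.invol_invol, X.invol_d]
  assoc x y z := by simp [barMul_apply, X.invol_mul, X.invol_invol, X.mul_assoc]

theorem products_two_apply (x : Fin 2 → A) : X.products 2 x = X.mul (x 0) (x 1) :=
  mulTensor_apply _ _ _ _ _ _ _

theorem bar_products : bar X.invol X.products = -conv X.barMul proj proj := by
  ext w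
  rw [Pi.neg_apply, conv_apply]
  match w with
  | [] => simp [splitSum, proj, bar_nil X.invol X.products rfl]
  | [x] =>
    rw [bar, ev_eq_zero rfl]
    simp [splitSum, proj]
  | [x, y] =>
    have : ev X.products (twist X.invol [x, y]) = X.mul (X.invol x) y := X.products_two_apply _
    rw [bar, this]
    simp [splitSum, proj, barMul_apply]
  | x :: y :: z :: w =>
    rw [bar, ev_eq_zero rfl]
    simp [splitSum, proj, splitSum_zero]

theorem parity_products : HasParity X.invol X.invol X.products fun n => n := by
  intro n x
  match n with
  | 0 => simp [products]
  | 1 => simp [products]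
  | 2 => simp [products_two_apply, X.invol_mul]
  | n + 3 => simp [products]

end FilteredDGAlgebra

/-- The relations of an `A_∞`-morphism to a dg-algebra form the Maurer–Cartan equation. -/
theorem aInfMorphism_relation_of_maurerCartan {X : FilteredDGAlgebra k A}
    {Y : FilteredComplex k B} {ν : ∀ n, Op k B B n} {F : ∀ n, Op k B A n}
    (hν : HasParity Y.invol Y.invol ν fun n => n) (hν0 : ν 0 = 0) (hν1 : ν 1 = 0)
    (hF : HasParity Y.invol X.invol F fun n => n + 1) (hF0 : bar Y.invol F [] = 0)
    (h : post X.d (bar Y.invol F) + conv X.barMul (bar Y.invol F) (bar Y.invol F) -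
      coder (k := k) (-Y.invol) (post Y.d proj - bar Y.invol ν) (bar Y.invol F) = 0)
    {n : ℕ} (x : Fin n → B) :
    delta Y X.toFilteredComplex (F n) (n + 1) x =
      ∑ c : Composition n with 2 ≤ c.length, (-1 : ℤ) ^ theta c •
        blockComp Y.invol c (X.products c.length) (fun i => F (c.blocksFun i))
          (fun i => c.blocksFun i + 1) x +
      ∑ l ∈ Icc 2 n, ∑ i ∈ range (n + 1 - l),
        (-1 : ℤ) ^ ((i + 1) * (l + 1) + n) • insertAt Y.invol (F (n + 1 - l)) i (ν l) l x := by
  refine aInfMorphism_relation hν hν0 hν1 rfl rfl hF ?_ x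
  have e : subst (bar Y.invol F) (bar X.invol X.products) =
      -conv X.barMul (bar Y.invol F) (bar Y.invol F) := by
    have h2 := subst_sub (bar Y.invol F) 0 (conv X.barMul proj proj)
    have h3 : subst (bar Y.invol F) (0 : List A → A) = 0 := by
      have := subst_sub (bar Y.invol F) (0 : List A → A) 0
      simpa using this
    rw [X.bar_products, ← zero_sub, h2, subst_conv, subst_proj _ hF0, h3]
    simp
  rw [e, ← sub_eq_zero, ← h]
  abel

end DGAlgebra

/-! ### The kernels in the bar construction -/

section Transfer
variable {k A B : Type*} [Field k] [AddCommGroup A] [Module k A] [AddCommGroup B] [Module k B]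

theorem splitSum_eq_sum_fin {α M : Type*} [AddCommMonoid M] {f : List α → List α → M}
    {w : List α} {m : ℕ} (hw : w.length = m + 2) (h0 : f [] w = 0) (h1 : f w [] = 0) :
    splitSum f w = ∑ j : Fin (m + 1), f (w.take (j + 1)) (w.drop (j + 1)) := by
  rw [splitSum_eq_sum_range, hw, sum_range_succ, sum_range_succ',
    Fin.sum_univ_eq_sum_range fun j => f (w.take (j + 1)) (w.drop (j + 1))]
  simp [h0, ← hw, h1]

theorem conv_eq_zero_of_length_le_one {α : Type*} {m : A →ₗ[k] A →ₗ[k] A} {a b : List α → A}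
    (ha : a [] = 0) (hb : b [] = 0) {w : List α} (hw : w.length < 2) : conv m a b w = 0 := by
  match w, hw with
  | [], _ => simp [conv_apply, splitSum, ha]
  | [x], _ => simp [conv_apply, splitSum, ha, hb]

variable (X : FilteredDGAlgebra k A) {Y : FilteredComplex k B}
  (T : TransferDiagram X.toFilteredComplex Y)

theorem coe_negOnePow_eq {e : ℤ} {j : ℕ} (h : Even (e - j)) :
    ((e.negOnePow : ℤˣ) : ℤ) = (-1) ^ j := by
  rw [(Int.negOnePow_eq_iff e j).2 h, Int.negOnePow_def]
  simp

theorem HasDegree.parity {X : FilteredComplex k A} {Y : FilteredComplex k B}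
    {φ : ∀ n, Op k A B n} {c : ℤ} {e : ℕ → ℕ}
    (h : ∀ n : ℕ, HasDegree X.gr Y.gr (φ n) ((c - n) • 1)) (he : ∀ n : ℕ, Even (c - n - e n)) :
    HasParity X.invol Y.invol φ e := by
  intro n x
  rw [(h n).invol, coe_negOnePow_eq (j := e n)]
  simpa using he n

theorem parity_hpKernel :
    HasParity X.invol X.invol (hpKernel X.invol X.mul T.h) fun n => n + 1 :=
  HasDegree.parity (isCompatible_gr (T := T)).hpKernel
    fun n => ⟨-n, by push_cast; ring⟩

theorem parity_transferProducts :
    HasParity Y.invol Y.invol (transferProducts X T) fun n => n :=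
  HasDegree.parity (isCompatible_gr (T := T)).transferProducts
    fun n => ⟨1 - n, by ring⟩

theorem parity_transferF :
    HasParity X.invol Y.invol (transferF X T) fun n => n + 1 :=
  HasDegree.parity (isCompatible_gr (T := T)).transferF
    fun n => ⟨-n, by push_cast; ring⟩

theorem parity_transferG :
    HasParity Y.invol X.invol (transferG X T) fun n => n + 1 :=
  HasDegree.parity (isCompatible_gr (T := T)).transferG
    fun n => ⟨-n, by push_cast; ring⟩

theorem parity_transferH :
    HasParity X.invol X.invol (transferH X T) fun n => n := by
  refine HasDegree.parity (c := 0) (fun n => ?_) fun n => ⟨-n, by ring⟩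
  rw [zero_sub]
  exact (isCompatible_gr (T := T)).transferH n

theorem parity_compAInf :
    HasParity X.invol X.invol (compAInf X.toFilteredComplex (transferG X T) (transferF X T))
      fun n => n + 1 :=
  HasDegree.parity (isCompatible_gr (T := T)).compAInf
    fun n => ⟨-n, by push_cast; ring⟩

theorem parity_idAInf : HasParity X.invol X.invol (idAInf k A) fun n => n + 1 :=
  HasDegree.parity (hasDegree_idAInf (k := k) (S := X.gr) 1)
    fun n => ⟨-n, by push_cast; ring⟩

theorem bar_idAInf (γ : A →ₗ[k] A) (w : List A) : bar γ (idAInf k A) w = proj w := by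
  match w with
  | [] => exact bar_nil γ _ rfl
  | [x] => exact one_smul ℤ x
  | x :: y :: w =>
    rw [bar, ev_eq_zero, smul_zero]
    · rfl
    · rfl

theorem bar_comp (γ : A →ₗ[k] A) (L : B →ₗ[k] B) (φ : ∀ n, Op k A B n) (w : List A) :
    bar γ (fun n => L.compMultilinearMap (φ n)) w = L (bar γ φ w) := by
  rw [bar, bar, map_zsmul]; rfl

theorem bar_hpKernel (w : List A) : bar X.invol (hpKernel X.invol X.mul T.h) w =
    proj w + T.h (bar X.invol (pKernel X.invol X.mul T.h) w) := by
  rw [← bar_comp]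
  match w with
  | [] =>
    rw [bar_nil _ _ (by simp [hpKernel, applyH, pKernel]), bar_nil _ _ (by simp [pKernel])]
    simp [proj]
  | [x] =>
    have h1 : bar X.invol (fun n => T.h.compMultilinearMap (pKernel X.invol X.mul T.h n)) [x] =
        0 := by
      rw [bar, ev_eq_zero, smul_zero]
      rw [length_twist]
      show T.h.compMultilinearMap (pKernel X.invol X.mul T.h 1) = 0
      rw [pKernel]
      ext x
      simp
    rw [h1, add_zero]
    exact one_smul ℤ x
  | x :: y :: w => exact (zero_add _).symm

theorem bar_pKernel (w : List A) : bar X.invol (pKernel X.invol X.mul T.h) w =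
    -conv X.barMul (bar X.invol (hpKernel X.invol X.mul T.h))
      (bar X.invol (hpKernel X.invol X.mul T.h)) w := by
  have hp0 : bar X.invol (hpKernel X.invol X.mul T.h) [] = 0 :=
    bar_nil _ _ (by simp [hpKernel, applyH, pKernel])
  rcases lt_or_ge w.length 2 with hw | hw
  · rw [conv_eq_zero_of_length_le_one hp0 hp0 hw, bar, ev_eq_zero]
    · simp
    · rw [length_twist]; interval_cases w.length <;> simp [pKernel]
  obtain ⟨m, hm⟩ : ∃ m, w.length = m + 2 := ⟨w.length - 2, by omega⟩
  obtain ⟨x, hx⟩ := exists_ofFn_eq (twist X.invol w) (n := m + 2) (by simpa using hm)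
  rw [conv_apply, splitSum_eq_sum_fin hm (by simp [hp0]) (by simp [hp0]), bar_eq _ _ hx, pKernel,
    _root_.sum_apply, smul_sum, ← sum_neg_distrib]
  refine sum_congr rfl fun j _ => ?_
  have hj := j.2
  have h := mulTensor_eq_bar_shift X.invol_invol X.mul
    (by omega : ((j : ℕ) + 1) + (m + 1 - (j : ℕ)) = m + 2) (hpKernel X.invol X.mul T.h)
    (hpKernel X.invol X.mul T.h) (e := (m + 1 - (j : ℕ)) + 1) (by push_cast; rfl) (x := x)
    (u := w.take (j + 1)) (v := w.drop (j + 1)) (by simp; omega) (by simp; omega)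
    (by rw [hx, List.take_append_drop])
  rw [_root_.smul_apply, smul_smul, ← pow_add]
  refine h.trans ?_
  rw [(parity_hpKernel X T).bar_even, X.barMul_apply]
  simp

theorem bar_compLinearMap (φ : ∀ n, Op k A A n) (w : List B) :
    bar Y.invol (fun n => (φ n).compLinearMap fun _ => T.g) w = bar X.invol φ (w.map T.g) := by
  have htw : ∀ w : List B, twist X.invol (w.map T.g) = (twist Y.invol w).map T.g := by
    intro w
    have hg : ∀ (j : ℕ) y, (X.invol ^ j) (T.g y) = T.g ((Y.invol ^ j) y) := by
      intro j
      induction j with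
      | zero => simp
      | succ j ih =>
        intro y
        rw [pow_succ, pow_succ, Module.End.mul_apply, Module.End.mul_apply, ← ih,
          Y.invol_map X.toFilteredComplex 0 (by simpa using T.g_mem)]
        simp
    induction w with
    | nil => rfl
    | cons x w ih => simp [twist, ih, hg]
  rw [bar, bar, htw, List.length_map]
  congr 1
  exact ev_eq φ (by simp) (by simp)

/-- In the bar construction `G = g - h (G * G)`. -/
theorem bar_transferG : bar Y.invol (transferG X T) = post T.g proj -
    post T.h (conv X.barMul (bar Y.invol (transferG X T)) (bar Y.invol (transferG X T))) := by
  ext w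
  have h1 : ∀ w, bar Y.invol (transferG X T) w =
    bar X.invol (hpKernel X.invol X.mul T.h) (w.map T.g) := bar_compLinearMap X T _
  simp only [post, LinearMap.compLeft_apply, Function.comp_apply, Pi.sub_apply, conv_apply, h1]
  rw [bar_hpKernel, bar_pKernel, proj_map, conv_apply, splitSum_map, map_neg, sub_eq_add_neg]

theorem bar_transferProducts : bar Y.invol (transferProducts X T) =
    -post T.f (conv X.barMul (bar Y.invol (transferG X T)) (bar Y.invol (transferG X T))) := by
  ext w
  have h1 : ∀ w, bar Y.invol (transferG X T) w =
    bar X.invol (hpKernel X.invol X.mul T.h) (w.map T.g) := bar_compLinearMap X T _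
  simp only [post, LinearMap.compLeft_apply, Function.comp_apply, Pi.neg_apply, conv_apply, h1]
  have h2 : bar Y.invol (transferProducts X T) w = T.f (bar Y.invol (fun n =>
    (pKernel X.invol X.mul T.h n).compLinearMap fun _ => T.g) w) := by
    rw [bar, bar, map_zsmul]; rfl
  rw [h2, bar_compLinearMap X T, bar_pKernel, conv_apply, splitSum_map, map_neg]

theorem bar_transferF : bar X.invol (transferF X T) =
    post T.f (bar X.invol (qKernel X.invol X.mul T.h (T.g ∘ₗ T.f))) := by
  ext w
  simp only [post, LinearMap.compLeft_apply, Function.comp_apply]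
  rw [bar, bar, map_zsmul]; rfl

theorem bar_transferH : bar X.invol (transferH X T) =
    post T.h (bar X.invol (qKernel X.invol X.mul T.h (T.g ∘ₗ T.f))) :=
  funext fun w => bar_comp _ _ _ w

theorem bar_compAInf : bar X.invol (compAInf X.toFilteredComplex (transferG X T) (transferF X T)) =
    subst (bar X.invol (transferF X T)) (bar Y.invol (transferG X T)) := by
  ext w
  obtain ⟨x, hx⟩ := exists_ofFn_eq (twist X.invol w) (n := w.length) (by simp)
  rw [bar_eq _ _ hx, ← sum_blockComp_eq_subst X.invol_invol _ (parity_transferF X T) hx, compAInf,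
    _root_.sum_apply]
  rfl

/-- In the bar construction `K = g f Q - h (K * K)` for the composite `K = G F`. -/
theorem bar_compAInf_eq :
    bar X.invol (compAInf X.toFilteredComplex (transferG X T) (transferF X T)) =
    post (T.g ∘ₗ T.f) (bar X.invol (qKernel X.invol X.mul T.h (T.g ∘ₗ T.f))) -
      post T.h (conv X.barMul
        (bar X.invol (compAInf X.toFilteredComplex (transferG X T) (transferF X T)))
        (bar X.invol (compAInf X.toFilteredComplex (transferG X T) (transferF X T)))) := by
  rw [bar_compAInf, ← subst_conv]
  conv_lhs => rw [bar_transferG]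
  rw [subst_sub]
  congr 1
  · refine (subst_comp _ T.g proj).trans ?_
    rw [subst_proj _ (bar_nil _ _ (by ext x; simp [transferF, qKernel])), bar_transferF]
    rfl
  · exact subst_comp _ T.h _

theorem compAInf_eq_gfKernel {m : ℕ} (hm : 0 < m) :
    gfKernel X.invol X.mul T.h (T.g ∘ₗ T.f) (qKernel X.invol X.mul T.h (T.g ∘ₗ T.f)) m =
      compAInf X.toFilteredComplex (transferG X T) (transferF X T) m := by
  rw [compAInf, ← sum_filter_add_sum_filter_not univ (fun c : Composition m => 2 ≤ c.length),
    add_comm, gfKernel]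
  congr 1
  · rw [sum_eq_single_of_mem (Composition.single m hm)]
    · ext x
      have h := blockComp_eq_ev X.invol (Composition.single m hm) (transferG X T)
        (transferF X T) (x := x) rfl
      have hw : List.splitWrtCompositionAux (List.ofFn x) (Composition.single m hm).blocks =
          [List.ofFn x] := by
        rw [Composition.single_blocks, List.splitWrtCompositionAux_cons, List.take_of_length_le]
        · rfl
        · simp
      rw [hw] at h
      rw [_root_.smul_apply, h, theta_eq_thetaList, Composition.single_blocks]
      have h1 : thetaList [m] = 0 := by simp [thetaList]
      rw [h1, pow_zero, one_smul]
      simp only [blockLetters, List.map_nil, List.sum_nil, pow_zero, Module.End.one_eq_id,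
        LinearMap.id_coe, List.map_id, ev_ofFn]
      exact (transferG_one X T [transferF X T m x].get).symm
    · simp
    · intro c hc hc'
      rw [mem_filter] at hc
      refine absurd ((Composition.eq_single_iff_length hm).2 ?_) hc'
      have := c.length_pos_of_pos hm
      omega

/-- A composition with two blocks. -/
def pairComposition {a b n : ℕ} (ha : 0 < a) (hb : 0 < b) (hn : a + b = n) : Composition n where
  blocks := [a, b]
  blocks_pos {i} hi := by
    simp only [List.mem_cons, List.not_mem_nil, or_false] at hi
    rcases hi with rfl | rfl <;> assumption
  blocks_sum := by simpa using hn

theorem sum_composition_eq_sum_pair {M : Type*} [AddCommMonoid M] {m : ℕ}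
    (F : Composition (m + 2) → M) (hF : ∀ c, c.length ≠ 2 → F c = 0) :
    ∑ c, F c = ∑ j : Fin (m + 1), F (pairComposition (Nat.succ_pos j)
      (Nat.sub_pos_of_lt j.2) (by omega : ((j : ℕ) + 1) + (m + 1 - (j : ℕ)) = m + 2)) := by
  classical
  refine (sum_of_injOn (fun j : Fin (m + 1) => pairComposition (Nat.succ_pos j)
    (Nat.sub_pos_of_lt j.2) (by omega)) ?_ (fun _ _ => mem_univ _) ?_ fun _ _ => rfl).symm
  · intro j _ j' _ h
    have := congrArg Composition.blocks h
    simp only [pairComposition, List.cons.injEq] at this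
    exact Fin.ext (by omega)
  · intro c _ hc
    refine hF c fun h2 => hc ?_
    obtain ⟨a, b, hab⟩ := List.length_eq_two.1 h2
    have h1 := c.blocks_sum
    have ha := c.blocks_pos (i := a) (by simp [hab])
    have hb := c.blocks_pos (i := b) (by simp [hab])
    simp only [hab, List.sum_cons, List.sum_nil] at h1
    refine ⟨⟨a - 1, by omega⟩, by simp, ?_⟩
    ext1
    simp only [pairComposition, hab, List.cons.injEq, and_true]
    omega

theorem blockComp_pair {a b n : ℕ} (ha : 0 < a) (hb : 0 < b) (hn : a + b = n)
    (ψ : ∀ i, Op k A A ((pairComposition ha hb hn).blocksFun i)) (e : Fin 2 → ℕ)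
    (x : Fin n → A) :
    blockComp X.invol (pairComposition ha hb hn) (X.products 2) ψ e x =
      mulTensor X.invol X.mul hn (ψ (0 : Fin 2)) (ψ (1 : Fin 2)) (e 1) x := by
  refine (blockComp_apply _ _ _ _ _ _).trans (Eq.trans ?_ (mulTensor_apply _ _ _ _ _ _ _).symm)
  refine (X.products_two_apply _).trans ?_
  have e0 : ∑ j ∈ Ioi (0 : Fin 2), e j = e 1 := by
    rw [show Ioi (0 : Fin 2) = {1} by decide]; simp
  have e1 : ∑ j ∈ Ioi (1 : Fin 2), e j = 0 := by
    rw [show Ioi (1 : Fin 2) = ∅ by decide]; simp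
  refine congrArg₂ (fun y z => X.mul y z) (congrArg (ψ (0 : Fin 2)) ?_)
    (congrArg (ψ (1 : Fin 2)) ?_)
  · funext i
    refine (congrArg (fun j => (X.invol ^ j) _) e0).trans ?_
    refine congrArg (fun y => (X.invol ^ e 1) (x y)) (Fin.ext ?_)
    refine (Composition.coe_embedding _ _ _).trans ?_
    exact (show (List.take 0 [a, b]).sum + (i : ℕ) = i by simp)
  · funext i
    refine (congrArg (fun j => (X.invol ^ j) _) e1).trans ?_
    rw [pow_zero]
    refine congrArg x ?_
    refine Fin.ext ((Composition.coe_embedding _ _ _).trans ?_)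
    exact (show (List.take 1 [a, b]).sum + (i : ℕ) = a + i by simp)

end Transfer

section Homotopy
variable {k A B : Type*} [Field k] [AddCommGroup A] [Module k A] [AddCommGroup B] [Module k B]
variable (X : FilteredDGAlgebra k A) {Y : FilteredComplex k B}
  (T : TransferDiagram X.toFilteredComplex Y)

/-- The recursion of the `q`-kernels in terms of the composite `G F`. -/
theorem qKernel_eq (m : ℕ) (x : Fin (m + 2) → A) :
    qKernel X.invol X.mul T.h (T.g ∘ₗ T.f) (m + 2) x =
      -mulTensor X.invol X.mul rfl (transferH X T (m + 1)) (idAInf k A 1) 0 x +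
      ∑ j : Fin (m + 1), (-1 : ℤ) ^ (((j : ℕ) + 1) * (m + 1 - (j : ℕ))) •
        mulTensor X.invol X.mul (by omega : ((j : ℕ) + 1) + (m + 1 - (j : ℕ)) = m + 2)
          (compAInf X.toFilteredComplex (transferG X T) (transferF X T) (j + 1))
          (transferH X T (m + 1 - (j : ℕ))) (m + 1 - (j : ℕ)) x := by
  rw [qKernel_add_two, _root_.add_apply, _root_.neg_apply, _root_.sum_apply]
  congr 1
  refine sum_congr rfl fun j _ => ?_
  rw [compAInf_eq_gfKernel X T (Nat.succ_pos j), _root_.smul_apply]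
  rfl

theorem bar_transferG_nil : bar Y.invol (transferG X T) [] = 0 :=
  bar_nil _ _ (by ext x; simp [transferG, hpKernel, applyH, pKernel])

theorem bar_compAInf_nil :
    bar X.invol (compAInf X.toFilteredComplex (transferG X T) (transferF X T)) [] = 0 := by
  rw [bar_compAInf]
  exact bar_transferG_nil X T

theorem bar_transferH_nil : bar X.invol (transferH X T) [] = 0 :=
  bar_nil _ _ (by ext x; simp [transferH, qKernel])

/-- In the bar construction `Q = 1 - H * 1 - σ K * H`. -/
theorem bar_qKernel : bar X.invol (qKernel X.invol X.mul T.h (T.g ∘ₗ T.f)) =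
    proj - conv X.barMul (bar X.invol (transferH X T)) proj - conv X.barMul (post (-X.invol)
      (bar X.invol (compAInf X.toFilteredComplex (transferG X T) (transferF X T))))
      (bar X.invol (transferH X T)) := by
  have hH0 := bar_transferH_nil X T
  have hK0 := bar_compAInf_nil X T
  ext w
  rw [Pi.sub_apply, Pi.sub_apply]
  rcases lt_or_ge w.length 2 with hw | hw
  · rw [conv_eq_zero_of_length_le_one hH0 rfl hw,
      conv_eq_zero_of_length_le_one (by simp [hK0]) hH0 hw, sub_zero, sub_zero]
    match w, hw with
    | [], _ => exact bar_nil _ _ (by simp [qKernel])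
    | [x], _ =>
      have : ev (qKernel X.invol X.mul T.h (T.g ∘ₗ T.f)) [x] = x := by
        change qKernel X.invol X.mul T.h (T.g ∘ₗ T.f) 1 [x].get = x
        rw [qKernel]
        rfl
      exact (one_smul ℤ _).trans this
  obtain ⟨m, hm⟩ : ∃ m, w.length = m + 2 := ⟨w.length - 2, by omega⟩
  obtain ⟨x, hx⟩ := exists_ofFn_eq (twist X.invol w) (n := m + 2) (by simpa using hm)
  have hproj : proj w = 0 := proj_eq_zero (by omega)
  rw [hproj, zero_sub, bar_eq _ _ hx, qKernel_eq, smul_add, sub_eq_add_neg]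
  congr 1
  · -- only the decomposition with a second factor of length one contributes
    rw [conv_apply, splitSum_eq_sum_fin hm (by simp [hH0]) (by simp [proj]),
      sum_eq_single_of_mem (Fin.last m) (mem_univ _)]
    · have h := mulTensor_eq_bar_shift X.invol_invol X.mul (rfl : m + 1 + 1 = m + 2)
        (transferH X T) (idAInf k A) (e := 0) (by decide) (x := x)
        (u := w.take (m + 1)) (v := w.drop (m + 1)) (by simp; omega) (by simp; omega)
        (by rw [hx, List.take_append_drop])
      rw [neg_one_pow_eq_of_zmod (b := (m + 2).choose 2)] at h
      · rw [smul_neg, h, (parity_transferH X T).bar_odd, bar_idAInf, X.barMul_apply]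
        simp
      · push_cast; linear_combination ((m : ZMod 2) + 1) * zmod_two_eq_zero
    · intro j _ hj
      have hj' : (j : ℕ) ≠ m := fun h => hj (Fin.ext h)
      rw [proj_eq_zero, map_zero]
      simp; omega
  · rw [conv_apply, splitSum_eq_sum_fin hm (by simp [hK0]) (by simp [hH0]), smul_sum,
      ← sum_neg_distrib]
    refine sum_congr rfl fun j _ => ?_
    have hj := j.2
    have h := mulTensor_eq_bar X.invol_invol X.mul
      (by omega : ((j : ℕ) + 1) + (m + 1 - (j : ℕ)) = m + 2)
      (compAInf X.toFilteredComplex (transferG X T) (transferF X T))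
      (transferH X T) (e := m + 1 - (j : ℕ)) rfl (x := x)
      (u := w.take (j + 1)) (v := w.drop (j + 1)) (by simp; omega) (by simp; omega)
      (by rw [hx, List.take_append_drop])
    rw [smul_smul, ← pow_add]
    refine h.trans ?_
    rw [X.barMul_apply]
    simp [X.invol_invol]

/-! ### The transferred structure -/

/-- The quadratic terms in the definition of an `A_∞`-homotopy, for a composition with two
blocks. -/
theorem homotopy_pair_terms (F G H : ∀ n, Op k A A n) {a b n : ℕ} (ha : 0 < a) (hb : 0 < b)
    (hn : a + b = n) (x : Fin n → A) (c : Composition n) (hc : c = pairComposition ha hb hn) :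
    ∑ i : Fin c.length,
        (-1 : ℤ) ^ (theta c + (c.length - ((i : ℕ) + 1)) + ∑ j ∈ Iio i, c.blocksFun j) •
          blockComp X.invol c (X.products c.length)
            (fun j => if j < i then G (c.blocksFun j)
              else if j = i then H (c.blocksFun j) else F (c.blocksFun j))
            (fun j => if j = i then c.blocksFun j else c.blocksFun j + 1) x =
      (-1 : ℤ) ^ (a * (b + 1) + 1) • mulTensor X.invol X.mul hn (H a) (F b) (b + 1) x +
        (-1 : ℤ) ^ (a * b) • mulTensor X.invol X.mul hn (G a) (H b) b x := by
  subst hc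
  have hθ : theta (pairComposition ha hb hn) = a * (b + 1) := by
    rw [theta_eq_thetaList]
    simp [pairComposition, thetaList]
  have h0 : ∀ f : Fin 2 → ℕ, ∑ j ∈ Iio (0 : Fin 2), f j = 0 := fun f => by
    rw [show Iio (0 : Fin 2) = ∅ by decide, sum_empty]
  have h1 : ∀ f : Fin 2 → ℕ, ∑ j ∈ Iio (1 : Fin 2), f j = f 0 := fun f => by
    rw [show Iio (1 : Fin 2) = {0} by decide, sum_singleton]
  refine (Fin.sum_univ_two _).trans (congrArg₂ (· + ·) ?_ ?_)
  · refine congrArg₂ (fun (s : ℤ) (y : A) => s • y) (congrArg _ ?_) (blockComp_pair X ha hb hn _ _ x)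
    rw [hθ]
    exact congrArg (a * (b + 1) + 1 + ·) (h0 _)
  · refine congrArg₂ (fun (s : ℤ) (y : A) => s • y) ?_ (blockComp_pair X ha hb hn _ _ x)
    refine (congrArg₂ (fun s t => (-1 : ℤ) ^ (s + 0 + t)) hθ (h1 _)).trans
      (neg_one_pow_eq_of_zmod ?_)
    change ((a * (b + 1) + 0 + a : ℕ) : ZMod 2) = (a * b : ℕ)
    push_cast
    linear_combination (a : ZMod 2) * zmod_two_eq_zero

/-- The `q`-kernels collect the terms without `G F` in the relations of an `A_∞`-homotopy from the
identity to `G F`. -/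
theorem qKernel_eq_homotopy_terms {n : ℕ} (hn : 1 ≤ n) (x : Fin n → A) :
    qKernel X.invol X.mul T.h (T.g ∘ₗ T.f) n x = idAInf k A n x +
      ∑ c : Composition n with 2 ≤ c.length, ∑ i : Fin c.length,
        (-1 : ℤ) ^ (theta c + (c.length - ((i : ℕ) + 1)) + ∑ j ∈ Iio i, c.blocksFun j) •
          blockComp X.invol c (X.products c.length)
            (fun j => if j < i then
                compAInf X.toFilteredComplex (transferG X T) (transferF X T) (c.blocksFun j)
              else if j = i then transferH X T (c.blocksFun j)
              else idAInf k A (c.blocksFun j))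
            (fun j => if j = i then c.blocksFun j else c.blocksFun j + 1) x := by
  have hprod : ∀ j, j ≠ 2 → X.products j = 0 := by
    intro j hj
    match j, hj with
    | 0, _ => rfl
    | 1, _ => rfl
    | j + 3, _ => rfl
  rcases eq_or_lt_of_le hn with rfl | hn2
  · rw [sum_eq_zero, add_zero, qKernel]
    · rfl
    · intro c hc
      have := c.length_le
      simp at hc
      omega
  obtain ⟨m, rfl⟩ : ∃ m, n = m + 2 := ⟨n - 2, by omega⟩
  rw [sum_filter_of_ne, sum_composition_eq_sum_pair]
  · rw [show idAInf k A (m + 2) x = 0 from rfl, zero_add, qKernel_eq]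
    refine Eq.trans ?_ (sum_congr rfl fun (j : Fin (m + 1)) _ => homotopy_pair_terms X (idAInf k A)
      (compAInf X.toFilteredComplex (transferG X T) (transferF X T)) (transferH X T)
      (Nat.succ_pos j) (Nat.sub_pos_of_lt j.2)
      (by omega : ((j : ℕ) + 1) + (m + 1 - (j : ℕ)) = m + 2) x _ rfl).symm
    rw [sum_add_distrib]
    congr 1
    have hone : ∀ b (hb : b = 1) (h : m + 1 + b = m + 2),
        (-1 : ℤ) ^ ((m + 1) * (b + 1) + 1) • mulTensor X.invol X.mul h (transferH X T (m + 1))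
          (idAInf k A b) (b + 1) x =
        -mulTensor X.invol X.mul rfl (transferH X T (m + 1)) (idAInf k A 1) 0 x := by
      rintro b rfl h
      rw [neg_one_pow_eq_of_zmod (b := 1), pow_one, neg_one_smul, mulTensor_apply,
        mulTensor_apply, pow_eq_of_zmod X.invol_invol (a := 1 + 1) (b := 0)]
      · push_cast; linear_combination zmod_two_eq_zero
      · push_cast; linear_combination ((m : ZMod 2) + 1) * zmod_two_eq_zero
    rw [sum_eq_single_of_mem (Fin.last m) (mem_univ _)]
    · exact (hone (m + 1 - m) (by omega) (by omega)).symm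
    · intro j _ hj
      have hj' : (j : ℕ) ≠ m := fun h => hj (Fin.ext h)
      obtain ⟨b, hb⟩ : ∃ b, m + 1 - (j : ℕ) = b + 2 := ⟨m - 1 - j, by omega⟩
      have h0 : idAInf k A (m + 1 - (j : ℕ)) = 0 := by rw [hb]; rfl
      rw [h0, mulTensor_apply, _root_.zero_apply, map_zero, smul_zero]
  · intro c hc
    refine sum_eq_zero fun i _ => ?_
    rw [hprod _ hc, blockComp_zero, smul_zero]
  · intro c _ hc
    by_contra h
    refine hc (sum_eq_zero fun i _ => ?_)
    rw [hprod _ (by omega), blockComp_zero, smul_zero]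

theorem transferProducts_zero : transferProducts X T 0 = 0 := by
  ext x; simp [transferProducts, pKernel]

theorem transferProducts_one : transferProducts X T 1 = 0 := by
  ext x; simp [transferProducts, pKernel]

theorem bar_codifferential : post Y.d proj - bar Y.invol (transferProducts X T) =
    post Y.d proj +
      post T.f (conv X.barMul (bar Y.invol (transferG X T)) (bar Y.invol (transferG X T))) := by
  rw [bar_transferProducts, sub_neg_eq_add]

theorem isFilteredAInfAlgebra_transferProducts :
    IsFilteredAInfAlgebra Y (transferProducts X T) where
  degree n _ a x hx := by
    have h := (isCompatible_gr (T := T)).transferProducts n a x hx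
    convert h using 2
    simp; ring
  filtered n _ p a x hx := by
    have h := (isCompatible_fil (T := T)).transferProducts n (fun i => (p i, a i)) x hx
    simp only [Prod.fst_add, Prod.snd_add, Prod.fst_sum, Prod.snd_sum, Prod.smul_mk,
      smul_zero, add_zero] at h
    convert h using 2
    simp; ring
  relation n hn x := by
    refine aInfAlgebra_relation (parity_transferProducts X T) (transferProducts_zero X T)
      (transferProducts_one X T) ?_ hn x
    have h := transferred_relation X.barAlgebra T.f_d T.g_d T.homotopy (bar_transferG X T)
      (bar_transferG_nil X T) (parity_transferG X T).bar_even rfl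
    rw [bar_codifferential, bar_transferProducts, map_neg, map_neg, ← neg_add]
    exact (congrArg Neg.neg h).trans neg_zero

theorem isFilteredAInfMorphism_transferG :
    IsFilteredAInfMorphism Y (transferProducts X T) X.toFilteredComplex X.products
      (transferG X T) where
  degree n _ a x hx := by
    have h := (isCompatible_gr (T := T)).transferG n a x hx
    convert h using 2
    simp; ring
  filtered n _ p a x hx := by
    have h := (isCompatible_fil (T := T)).transferG n (fun i => (p i, a i)) x hx
    simp only [Prod.fst_add, Prod.snd_add, Prod.fst_sum, Prod.snd_sum, Prod.smul_mk,
      smul_zero, add_zero] at h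
    convert h using 2
    simp; ring
  relation n _ x := by
    refine aInfMorphism_relation_of_maurerCartan (parity_transferProducts X T)
      (transferProducts_zero X T) (transferProducts_one X T) (parity_transferG X T)
      (bar_transferG_nil X T) ?_ x
    rw [bar_codifferential]
    exact maurerCartan_transfer X.barAlgebra T.g_d T.homotopy (bar_transferG X T)
      (bar_transferG_nil X T) (parity_transferG X T).bar_even rfl

/-- The structural identities of the `q`-kernel of a transfer diagram. -/
theorem bar_identities :
    let Q := bar X.invol (qKernel X.invol X.mul T.h (T.g ∘ₗ T.f))
    let K := bar X.invol (compAInf X.toFilteredComplex (transferG X T) (transferF X T))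
    let H := bar X.invol (transferH X T)
    let D := coder (k := k) (A := A) (-X.invol) (post X.d proj - bar X.invol X.products)
    post X.d Q + conv X.barMul K K - D Q = 0 ∧ post X.d K + conv X.barMul K K - D K = 0 ∧
      post X.d H + D H - (Q - K) = 0 := by
  refine qKernel_identities X.barAlgebra (p := T.g ∘ₗ T.f) (h := T.h) ?_ T.homotopy ?_
    (bar_compAInf_eq X T) (bar_qKernel X T) (bar_transferH X T)
    (bar_compAInf_nil X T) (bar_transferH_nil X T)
    (parity_compAInf X T).bar_even (parity_transferH X T).bar_odd
  · intro x
    simp [T.f_d, T.g_d]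
  · rw [X.bar_products, sub_neg_eq_add]

theorem isFilteredAInfMorphism_transferF :
    IsFilteredAInfMorphism X.toFilteredComplex X.products Y (transferProducts X T)
      (transferF X T) where
  degree n _ a x hx := by
    have h := (isCompatible_gr (T := T)).transferF n a x hx
    convert h using 2
    simp; ring
  filtered n _ p a x hx := by
    have h := (isCompatible_fil (T := T)).transferF n (fun i => (p i, a i)) x hx
    simp only [Prod.fst_add, Prod.snd_add, Prod.fst_sum, Prod.snd_sum, Prod.smul_mk,
      smul_zero, add_zero] at h
    convert h using 2
    simp; ring
  relation n _ x := by
    refine aInfMorphism_relation X.parity_products rfl rfl (transferProducts_zero X T)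
      (transferProducts_one X T) (parity_transferF X T) ?_ x
    have h := congrArg (post T.f) (bar_identities X T).1
    have hfd : ∀ a : List A → A, post Y.d (post T.f a) = post T.f (post X.d a) :=
      fun a => funext fun w => (T.f_d _).symm
    have e : subst (bar X.invol (transferF X T)) (bar Y.invol (transferProducts X T)) =
        -post T.f (conv X.barMul
          (bar X.invol (compAInf X.toFilteredComplex (transferG X T) (transferF X T)))
          (bar X.invol (compAInf X.toFilteredComplex (transferG X T) (transferF X T)))) := by
      rw [bar_transferProducts, bar_compAInf, ← subst_conv]
      exact subst_comp _ (-T.f) _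
    rw [e, bar_transferF, hfd, coder_post, ← sub_eq_zero, ← map_sub, sub_neg_eq_add, ← map_add,
      sub_add_eq_add_sub, h, map_zero]

theorem isFilteredAInfMorphism_idAInf :
    IsFilteredAInfMorphism X.toFilteredComplex X.products X.toFilteredComplex X.products
      (idAInf k A) where
  degree n _ a x hx := by
    have h := hasDegree_idAInf (k := k) (S := X.gr) 1 n a x hx
    convert h using 2
    simp; ring
  filtered n _ p a x hx := by
    have h := hasDegree_idAInf (k := k) (S := fun q : ℤ × ℤ => X.fil q.1 q.2) (0, 1) n
      (fun i => (p i, a i)) x hx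
    simp only [Prod.fst_add, Prod.snd_add, Prod.fst_sum, Prod.snd_sum, Prod.smul_mk,
      smul_zero, add_zero] at h
    convert h using 2
    simp; ring
  relation n _ x := by
    refine aInfMorphism_relation_of_maurerCartan X.parity_products rfl rfl (parity_idAInf X)
      (bar_nil _ _ rfl) ?_ x
    have h : bar X.invol (idAInf k A) = proj := funext (bar_idAInf X.invol)
    rw [h, X.bar_products, coder_proj]
    abel

theorem isFilteredAInfMorphism_compAInf :
    IsFilteredAInfMorphism X.toFilteredComplex X.products X.toFilteredComplex X.products
      (compAInf X.toFilteredComplex (transferG X T) (transferF X T)) where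
  degree n _ a x hx := by
    have h := (isCompatible_gr (T := T)).compAInf n a x hx
    convert h using 2
    simp; ring
  filtered n _ p a x hx := by
    have h := (isCompatible_fil (T := T)).compAInf n (fun i => (p i, a i)) x hx
    simp only [Prod.fst_add, Prod.snd_add, Prod.fst_sum, Prod.snd_sum, Prod.smul_mk,
      smul_zero, add_zero] at h
    convert h using 2
    simp; ring
  relation n _ x :=
    aInfMorphism_relation_of_maurerCartan X.parity_products rfl rfl (parity_compAInf X T)
      (bar_compAInf_nil X T) (bar_identities X T).2.1 x

theorem isFilteredAInfHomotopy_transferH :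
    IsFilteredAInfHomotopy X.toFilteredComplex X.products X.toFilteredComplex X.products
      (idAInf k A) (compAInf X.toFilteredComplex (transferG X T) (transferF X T))
      (transferH X T) where
  source := isFilteredAInfMorphism_idAInf X
  target := isFilteredAInfMorphism_compAInf X T
  degree n _ a x hx := by
    have h := (isCompatible_gr (T := T)).transferH n a x hx
    convert h using 2
    simp; ring
  filtered n _ p a x hx := by
    have h := (isCompatible_fil (T := T)).transferH n (fun i => (p i, a i)) x hx
    simp only [Prod.fst_add, Prod.snd_add, Prod.fst_sum, Prod.snd_sum, Prod.smul_mk,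
      smul_zero, add_zero] at h
    convert h using 2
    simp; ring
  relation n hn x := by
    obtain ⟨w, hw⟩ : ∃ w, List.ofFn x = twist X.invol w :=
      ⟨twist X.invol (List.ofFn x), (twist_twist X.invol_invol _).symm⟩
    have e1 := delta_eq_bar X.toFilteredComplex X.toFilteredComplex (transferH X T) n hw
    have e2 := sum_insertAt_eq_bar X.invol_invol (transferH X T) X.parity_products rfl rfl hw
    have e3 := congrFun (bar_identities X T).2.2 w
    have e4 : ∑ l ∈ Icc 2 n, ∑ i ∈ range (n + 1 - l), (-1 : ℤ) ^ ((i + 1) * (l + 1) + n + 1) •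
        insertAt X.invol (transferH X T (n + 1 - l)) i (X.products l) l x =
        -∑ l ∈ Icc 2 n, ∑ i ∈ range (n + 1 - l), (-1 : ℤ) ^ ((i + 1) * (l + 1) + n) •
          insertAt X.invol (transferH X T (n + 1 - l)) i (X.products l) l x := by
      simp only [← sum_neg_distrib, neg_neg_one_pow_smul]
    rw [Pi.sub_apply, Pi.add_apply, coder_bar_sub, Pi.sub_apply, bar_eq _ _ hw,
      bar_eq _ (compAInf _ _ _) hw, qKernel_eq_homotopy_terms X T hn, Pi.zero_apply,
      sub_eq_zero] at e3
    refine neg_one_pow_smul_cancel (n.choose 2) ?_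
    rw [e1, e4, smul_add, smul_neg, e2, neg_neg, neg_one_pow_eq_of_zmod (b := 0), pow_zero,
      one_smul]
    · simp only [smul_add, smul_sub] at e3 ⊢
      rw [← add_sub_right_comm, ← e3]
      simp only [post, LinearMap.compLeft_apply, Function.comp_apply]
      abel
    · push_cast; linear_combination (n : ZMod 2) * zmod_two_eq_zero

end Homotopy

end FilteredTransfer

theorem proposition3p5 {k A B : Type*} [Field k] [AddCommGroup A] [Module k A]
    [AddCommGroup B] [Module k B]
    (X : FilteredTransfer.FilteredDGAlgebra k A) (Y : FilteredTransfer.FilteredComplex k B)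
    (T : FilteredTransfer.TransferDiagram X.toFilteredComplex Y) :
    FilteredTransfer.IsFilteredAInfAlgebra Y (FilteredTransfer.transferProducts X T) ∧
    FilteredTransfer.IsFilteredAInfMorphism X.toFilteredComplex X.products
      Y (FilteredTransfer.transferProducts X T) (FilteredTransfer.transferF X T) ∧
    FilteredTransfer.IsFilteredAInfMorphism Y (FilteredTransfer.transferProducts X T)
      X.toFilteredComplex X.products (FilteredTransfer.transferG X T) ∧
    FilteredTransfer.IsFilteredAInfHomotopy X.toFilteredComplex X.products
      X.toFilteredComplex X.products
      (FilteredTransfer.idAInf k A)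
      (FilteredTransfer.compAInf X.toFilteredComplex (FilteredTransfer.transferG X T)
        (FilteredTransfer.transferF X T))
      (FilteredTransfer.transferH X T) := by
  exact ⟨FilteredTransfer.isFilteredAInfAlgebra_transferProducts X T,
    FilteredTransfer.isFilteredAInfMorphism_transferF X T,
    FilteredTransfer.isFilteredAInfMorphism_transferG X T,
    FilteredTransfer.isFilteredAInfHomotopy_transferH X T⟩
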